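/- **Model.** Time is the number of unit-cost steps of a uniform real random access machine: one fixed program for all inputs, with natural-number registers, natural-number arrays and real arrays. The unit-cost operations are loads and stores at computed addresses; addition and truncated subtraction of natural numbers; exact $+,-,\times,/$ on reals; comparisons; conversion of a natural number to a real; arbitrary real constants; and evaluation of the functions of a fixed, arbitrary (possibly empty) family of elementary functions $\mathbb{R}\to\mathbb{R}$. Memory outside the input has arbitrary initial contents. **Definitions.** Let $f:\mathbb{R}\to\mathbb{R}$ and $d\in\mathbb{N}$. The function $f$ is *$d$-cordial* if there is a program that, given $a,b\ge 1$, real sequences $(x_i)_{i=1}^a$, $(y_j)_{j=1}^b$ and $v\in\mathbb{R}^b$, computes $\mathbf{M}v$ for $\mathbf{M}=[f(x_i+y_j)]_{i=1,\dots,a}^{j=1,\dots,b}$ in at most $T(a+b)$ steps, where $T(n)=O(n\log^{d} n)$ as $n\to\infty$. For a tree $\mathcal{T}$ on $N$ vertices with positive real edge weights and a tensor field $\mathbf{X}\in\mathbb{R}^{N\times d_1\times\dots\times d_s}$ with all $d_i\ge 1$, *$f$-integration* is the computation of the field $$(\mathbf{M}_f\mathbf{X})[u]=\sum_{v\in V(\mathcal{T})}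 f(\mathrm{dist}(u,v))\,\mathbf{X}[v],\qquad u\in V(\mathcal{T}),$$ where $\mathrm{dist}$ is the shortest-path distance in $\mathcal{T}$. The input consists of $N$, the number $d_1\cdots d_s$ of components, the list of the $N-1$ edges (in any order and orientation) with their weights, and $\mathbf{X}$. **Lemma.** If $f$ is $d$-cordial, then $f$-integration on general weighted trees with $N$ vertices can be conducted exactly in time $O(N\log^{d+1}N)$ per component of the field. That is, there are one program, on the machine with the same elementary functions, and a function $T$ with $T(N)=O(N\log^{d+1}N)$ as $N\to\infty$, such that for every $N\ge1$, every weighted tree on $N$ vertices and every tensor field $\mathbf{X}$ of shape $N\times d_1\times\dots\times d_s$, the program outputs $\mathbf{M}_f\mathbf{X}$ after at most $T(N)\cdot d_1\cdots d_s$ steps. -/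

import Mathlib

open Filter Asymptotics Matrix

/-! ### A real random access machine

Memory: natural-number registers, natural-number arrays and real arrays (unbounded, addressed by
natural numbers).  A program names finitely many registers and arrays.  Unit-cost operations:
loads and stores with computed addresses, `+` and truncated `-` on natural numbers,
`+ - * /` on reals, comparisons, conversion of a natural number to a real, arbitrary real constants,
and the evaluation of the functions of a fixed family `prim : ι → ℝ → ℝ` (empty for the plain
real RAM; it may hold e.g. `exp`, `cos`).  There is no rounding of reals to integers, and no
unit-cost multiplication of integers. -/

namespace RealRAM

/-- Memory contents of the machine. -/
structure State where
  /-- natural-number registers -/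
  reg : ℕ → ℕ
  /-- `nat a i` is cell `i` of natural-number array number `a` -/
  nat : ℕ → ℕ → ℕ
  /-- `real a i` is cell `i` of real array number `a` -/
  real : ℕ → ℕ → ℝ

/-- Natural-number expressions. -/
inductive NExp where
  | const (n : ℕ)
  | reg (x : ℕ)
  | load (a : ℕ) (e : NExp)
  | add (e e' : NExp)
  | sub (e e' : NExp)

/-- Real expressions; `ι` indexes the elementary real functions of the machine. -/
inductive RExp (ι : Type*) where
  | const (r : ℝ)
  | load (a : ℕ) (e : NExp)
  | ofNat (e : NExp)
  | add (e e' : RExp ι)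
  | sub (e e' : RExp ι)
  | mul (e e' : RExp ι)
  | div (e e' : RExp ι)
  | prim (i : ι) (e : RExp ι)

/-- Tests: comparisons and their Boolean combinations. -/
inductive Test (ι : Type*) where
  | nlt (e e' : NExp)
  | neq (e e' : NExp)
  | rlt (e e' : RExp ι)
  | req (e e' : RExp ι)
  | not (b : Test ι)
  | and (b b' : Test ι)

/-- Programs. -/
inductive Prog (ι : Type*) where
  | skip
  | setReg (x : ℕ) (e : NExp)
  | setNat (a : ℕ) (addr : NExp) (e : NExp)
  | setReal (a : ℕ) (addr : NExp) (e : RExp ι)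
  | seq (c c' : Prog ι)
  | ite (b : Test ι) (c c' : Prog ι)
  | while (b : Test ι) (c : Prog ι)

/-- Value of a natural-number expression. -/
def NExp.eval (s : State) : NExp → ℕ
  | .const n => n
  | .reg x => s.reg x
  | .load a e => s.nat a (e.eval s)
  | .add e e' => e.eval s + e'.eval s
  | .sub e e' => e.eval s - e'.eval s

/-- Number of operations needed to evaluate a natural-number expression. -/
def NExp.cost : NExp → ℕ
  | .const _ => 1
  | .reg _ => 1
  | .load _ e => e.cost + 1
  | .add e e' => e.cost + e'.cost + 1
  | .sub e e' => e.cost + e'.cost + 1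

variable {ι : Type*} (prim : ι → ℝ → ℝ)

/-- Value of a real expression. -/
noncomputable def RExp.eval (s : State) : RExp ι → ℝ
  | .const r => r
  | .load a e => s.real a (e.eval s)
  | .ofNat e => (e.eval s : ℝ)
  | .add e e' => e.eval s + e'.eval s
  | .sub e e' => e.eval s - e'.eval s
  | .mul e e' => e.eval s * e'.eval s
  | .div e e' => e.eval s / e'.eval s
  | .prim i e => prim i (e.eval s)

/-- Number of operations needed to evaluate a real expression. -/
def RExp.cost : RExp ι → ℕ
  | .const _ => 1
  | .load _ e => e.cost + 1
  | .ofNat e => e.cost + 1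
  | .add e e' => e.cost + e'.cost + 1
  | .sub e e' => e.cost + e'.cost + 1
  | .mul e e' => e.cost + e'.cost + 1
  | .div e e' => e.cost + e'.cost + 1
  | .prim _ e => e.cost + 1

/-- The test succeeds in state `s`. -/
def Test.Holds (s : State) : Test ι → Prop
  | .nlt e e' => e.eval s < e'.eval s
  | .neq e e' => e.eval s = e'.eval s
  | .rlt e e' => e.eval prim s < e'.eval prim s
  | .req e e' => e.eval prim s = e'.eval prim s
  | .not b => ¬ b.Holds s
  | .and b b' => b.Holds s ∧ b'.Holds s

/-- Number of operations needed to evaluate a test. -/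
def Test.cost : Test ι → ℕ
  | .nlt e e' => e.cost + e'.cost + 1
  | .neq e e' => e.cost + e'.cost + 1
  | .rlt e e' => e.cost + e'.cost + 1
  | .req e e' => e.cost + e'.cost + 1
  | .not b => b.cost + 1
  | .and b b' => b.cost + b'.cost + 1

/-- Store `n` in register `x`. -/
def State.writeReg (s : State) (x n : ℕ) : State :=
  { s with reg := Function.update s.reg x n }

/-- Store `n` in cell `i` of natural-number array `a`. -/
def State.writeNat (s : State) (a i n : ℕ) : State :=
  { s with nat := Function.update s.nat a (Function.update (s.nat a) i n) }

/-- Store `r` in cell `i` of real array `a`. -/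
def State.writeReal (s : State) (a i : ℕ) (r : ℝ) : State :=
  { s with real := Function.update s.real a (Function.update (s.real a) i r) }

/-- `Runs prim c s t s'`: started in state `s`, the program `c` halts after exactly `t` steps
in state `s'`. -/
inductive Runs : Prog ι → State → ℕ → State → Prop
  | skip (s : State) : Runs .skip s 1 s
  | setReg (s : State) (x : ℕ) (e : NExp) :
      Runs (.setReg x e) s (e.cost + 1) (s.writeReg x (e.eval s))
  | setNat (s : State) (a : ℕ) (i e : NExp) :
      Runs (.setNat a i e) s (i.cost + e.cost + 1) (s.writeNat a (i.eval s) (e.eval s))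
  | setReal (s : State) (a : ℕ) (i : NExp) (e : RExp ι) :
      Runs (.setReal a i e) s (i.cost + e.cost + 1) (s.writeReal a (i.eval s) (e.eval prim s))
  | seq {c c' : Prog ι} {s s' s'' : State} {t t' : ℕ} (h : Runs c s t s')
      (h' : Runs c' s' t' s'') : Runs (.seq c c') s (t + t') s''
  | iteTrue {b : Test ι} {c c' : Prog ι} {s s' : State} {t : ℕ} (hb : b.Holds prim s)
      (h : Runs c s t s') : Runs (.ite b c c') s (b.cost + 1 + t) s'
  | iteFalse {b : Test ι} {c c' : Prog ι} {s s' : State} {t : ℕ} (hb : ¬ b.Holds prim s)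
      (h : Runs c' s t s') : Runs (.ite b c c') s (b.cost + 1 + t) s'
  | whileFalse {b : Test ι} {c : Prog ι} {s : State} (hb : ¬ b.Holds prim s) :
      Runs (.while b c) s (b.cost + 1) s
  | whileTrue {b : Test ι} {c : Prog ι} {s s' s'' : State} {t t' : ℕ} (hb : b.Holds prim s)
      (h : Runs c s t s') (h' : Runs (.while b c) s' t' s'') :
      Runs (.while b c) s (b.cost + 1 + t + t') s''

end RealRAM

/-! ### Cordial functions -/

/-- The memory holds the data of the multiplication of `[f (x i + y j)]` with `v`: the sizes `a`, `b`
in registers `0`, `1`, and `x`, `y`, `v` in real arrays `0`, `1`, `2`.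
The rest of the memory is arbitrary (uninitialized). -/
structure StoresSumMatrixInput (s : RealRAM.State) {a b : ℕ} (x : Fin a → ℝ) (y v : Fin b → ℝ) :
    Prop where
  rows : s.reg 0 = a
  cols : s.reg 1 = b
  mem_x : ∀ i : Fin a, s.real 0 i = x i
  mem_y : ∀ j : Fin b, s.real 1 j = y j
  mem_v : ∀ j : Fin b, s.real 2 j = v j

/-- The program `P` multiplies, for all `a, b ≥ 1` and all real sequences `x`, `y`, the `a × b`
matrix `[f (x i + y j)]` with any given vector, in at most `T (a + b)` steps.
The product is left in real array `3`. -/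
def MultipliesSumMatrices {ι : Type*} (prim : ι → ℝ → ℝ) (f : ℝ → ℝ) (P : RealRAM.Prog ι)
    (T : ℕ → ℕ) : Prop :=
  ∀ (a b : ℕ), 1 ≤ a → 1 ≤ b → ∀ (x : Fin a → ℝ) (y v : Fin b → ℝ) (s : RealRAM.State),
    StoresSumMatrixInput s x y v →
    ∃ (t : ℕ) (s' : RealRAM.State), RealRAM.Runs prim P s t s' ∧ t ≤ T (a + b) ∧
      ∀ i : Fin a, s'.real 3 i = ((Matrix.of fun i j => f (x i + y j)) *ᵥ v) i

/-- `f` is `d`-cordial: matrix-vector multiplication with the matrices `[f (x i + y j)]` of size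
`a × b` can be conducted in time `O((a + b) log ^ d (a + b))`. -/
def IsCordial {ι : Type*} (prim : ι → ℝ → ℝ) (d : ℕ) (f : ℝ → ℝ) : Prop :=
  ∃ (P : RealRAM.Prog ι) (T : ℕ → ℕ),
    (fun n => (T n : ℝ)) =O[atTop] (fun n : ℕ => (n : ℝ) * Real.log n ^ d) ∧
    MultipliesSumMatrices prim f P T

/-! ### Integration of tensor fields on weighted trees -/

/-- Shortest-path distance in the graph `G` with edge weights `w`: the least total weight of a path
from `u` to `v`. -/
noncomputable def weightedDist {V : Type*} (G : SimpleGraph V) (w : Sym2 V → ℝ) (u v : V) : ℝ :=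
  ⨅ p : G.Path u v, (p.1.edges.map w).sum

/-- The `f`-distance matrix `[f (dist (u, v))]` of a weighted graph. -/
noncomputable def fDistanceMatrix {V : Type*} (G : SimpleGraph V) (w : Sym2 V → ℝ) (f : ℝ → ℝ) :
    Matrix V V ℝ :=
  Matrix.of fun u v => f (weightedDist G w u v)

/-- The memory holds a weighted tree `(G, w)` on the vertices `0, …, N - 1` and a tensor field `X` on
it, whose value at each vertex is a tensor of shape `dims`: the number `N` of vertices and the number
`∏ i, dims i` of components in registers `0`, `1`; the `N - 1` edges, listed in any order and with
any orientation, with end points in natural-number arrays `0`, `1` and weights in real array `0`;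
the field in real array `1`, vertex by vertex, the components in mixed radix order.
The rest of the memory is arbitrary (uninitialized). -/
structure StoresTreeField (s : RealRAM.State) {N : ℕ} (G : SimpleGraph (Fin N))
    (w : Sym2 (Fin N) → ℝ) {r : ℕ} {dims : Fin r → ℕ}
    (X : Fin N → (∀ i, Fin (dims i)) → ℝ) : Prop where
  vertices : s.reg 0 = N
  components : s.reg 1 = ∏ i, dims i
  edges : ∃ src dst : Fin (N - 1) → Fin N,
    Set.range (fun k => s(src k, dst k)) = G.edgeSet ∧
    ∀ k : Fin (N - 1), s.nat 0 k = src k ∧ s.nat 1 k = dst k ∧ s.real 0 k = w s(src k, dst k)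
  field : ∀ (u : Fin N) (c : ∀ i, Fin (dims i)),
    s.real 1 (u * (∏ i, dims i) + finPiFinEquiv c) = X u c

/-- The program `P` performs `f`-integration on weighted trees: for every tree on `N` vertices with
positive edge weights and every tensor field `X` of shape `N × dims 0 × ⋯ × dims (r - 1)`, it leaves the
product of the `f`-distance matrix with `X` in real array `2`, in the layout of `X`, in at most
`T N` steps per component of the tensors. -/
def IntegratesTreeFields {ι : Type*} (prim : ι → ℝ → ℝ) (f : ℝ → ℝ) (P : RealRAM.Prog ι)
    (T : ℕ → ℕ) : Prop :=
  ∀ (N : ℕ) (G : SimpleGraph (Fin N)) (w : Sym2 (Fin N) → ℝ), G.IsTree →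
    (∀ e ∈ G.edgeSet, 0 < w e) →
    ∀ (r : ℕ) (dims : Fin r → ℕ), (∀ i, 1 ≤ dims i) →
    ∀ (X : Fin N → (∀ i, Fin (dims i)) → ℝ) (s : RealRAM.State), StoresTreeField s G w X →
    ∃ (t : ℕ) (s' : RealRAM.State), RealRAM.Runs prim P s t s' ∧ t ≤ T N * ∏ i, dims i ∧
      ∀ (u : Fin N) (c : ∀ i, Fin (dims i)),
        s'.real 2 (u * (∏ i, dims i) + finPiFinEquiv c) =
          (fDistanceMatrix G w f *ᵥ fun v => X v c) u

/-! The algorithm is a centroid decomposition. Let `c` be a vertex of a tree and `h u` its distance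
from `u`. A path between two different branches at `c`, or between `c` and a branch, runs through
`c`, so such a pair has distance `h u + h v`. The contribution of all these pairs is the product
with `[f (h u + h v)]` over the whole tree, minus the same products over the single branches. Each
of them is one call of the given multiplication program. If `c` is a centroid, the branches have at
most half of the vertices, so `Nat.clog 2 N` levels reduce everything to single vertices.

All pieces of one level are handled together in a round, as the classes of a labelling. By
`IsHalving.classIntegral_eq`, the accumulated result plus the integral restricted to the classes is
invariant under a round. At the start the result is `f 0 * X` and there is one class. At the end the
classes are single vertices and contribute `f 0 * X`, which leaves the full integral
(`exec_rounds`). Outside the given program only the value `f 0` is needed, as a constant of the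
program.

The centroids of all classes are found together in linear time. A leaf is merged into its neighbour
as long as it carries at most half of the weight of its class. When no leaf can be removed, at most
one vertex of each class is left (`Peeling.alive_unique`), because two leaves would each carry more
than half. The vertices merged along a branch number at most half of the class
(`Peeling.isHalving`). Adjacency lists are unnecessary: the number, the sum and the weight sum of
the remaining neighbours identify the only neighbour of a leaf and the edge to it.

A class of `n` vertices costs `T (2 * n) + O(n)` steps, and `T (2 * n) ≤ n * r` with `r =
doubledRate T N = O(log ^ d N)`. The class sizes add up to `N`, so a round costs `O(N * r)`, and the
logarithmic number of rounds gives the last factor. The programs are verified with `Exec`, a Hoare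
triple with a time bound. Syntactic frames carry the untouched memory along, and relocation keeps
the given program away from the memory of the caller. -/

namespace RealRAM

variable {ι : Type*} (prim : ι → ℝ → ℝ)

infixr:30 " ;; " => Prog.seq

/-! ### Total correctness with a time bound -/

/-- Started in `s`, the program `c` halts within `t` steps in a state satisfying `Q`. -/
def Exec (c : Prog ι) (s : State) (t : ℕ) (Q : State → Prop) : Prop :=
  ∃ (t' : ℕ) (s' : State), Runs prim c s t' s' ∧ t' ≤ t ∧ Q s'

variable {prim}

theorem Exec.mono {c : Prog ι} {s : State} {t t' : ℕ} {Q Q' : State → Prop}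
    (h : Exec prim c s t Q) (ht : t ≤ t') (hQ : ∀ s', Q s' → Q' s') : Exec prim c s t' Q' := by
  obtain ⟨u, s', hr, hu, hq⟩ := h
  exact ⟨u, s', hr, hu.trans ht, hQ _ hq⟩

theorem Exec.seq {c c' : Prog ι} {s : State} {t t' : ℕ} {Q : State → Prop}
    (h : Exec prim c s t (fun s₁ => Exec prim c' s₁ t' Q)) : Exec prim (c ;; c') s (t + t') Q := by
  obtain ⟨u, s', hr, hu, u', s'', hr', hu', hq⟩ := h
  exact ⟨u + u', s'', .seq hr hr', by omega, hq⟩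

theorem Exec.seq_of {c c' : Prog ι} {s : State} {t t' : ℕ} {Q R : State → Prop}
    (h : Exec prim c s t R) (h' : ∀ s₁, R s₁ → Exec prim c' s₁ t' Q) :
    Exec prim (c ;; c') s (t + t') Q :=
  (h.mono le_rfl h').seq

/-! ### Memory updates -/

@[simp] theorem State.writeReg_reg (s : State) (x n y : ℕ) :
    (s.writeReg x n).reg y = if y = x then n else s.reg y := by
  simp [State.writeReg, Function.update_apply]

@[simp] theorem State.writeReg_nat (s : State) (x n : ℕ) : (s.writeReg x n).nat = s.nat := rfl

@[simp] theorem State.writeReg_real (s : State) (x n : ℕ) : (s.writeReg x n).real = s.real := rfl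

@[simp] theorem State.writeNat_reg (s : State) (a i n : ℕ) : (s.writeNat a i n).reg = s.reg := rfl

@[simp] theorem State.writeNat_nat (s : State) (a i n b : ℕ) :
    (s.writeNat a i n).nat b = if b = a then Function.update (s.nat a) i n else s.nat b := by
  simp [State.writeNat, Function.update_apply]

@[simp] theorem State.writeNat_real (s : State) (a i n : ℕ) :
    (s.writeNat a i n).real = s.real := rfl

@[simp] theorem State.writeReal_reg (s : State) (a i : ℕ) (r : ℝ) :
    (s.writeReal a i r).reg = s.reg := rfl

@[simp] theorem State.writeReal_nat (s : State) (a i : ℕ) (r : ℝ) :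
    (s.writeReal a i r).nat = s.nat := rfl

@[simp] theorem State.writeReal_real (s : State) (a i b : ℕ) (r : ℝ) :
    (s.writeReal a i r).real b =
      if b = a then Function.update (s.real a) i r else s.real b := by
  simp [State.writeReal, Function.update_apply]

@[simp] theorem State.ite_reg (P : Prop) [Decidable P] (s s' : State) (x : ℕ) :
    (if P then s else s').reg x = if P then s.reg x else s'.reg x := by split_ifs <;> rfl

@[simp] theorem State.ite_nat (P : Prop) [Decidable P] (s s' : State) (a : ℕ) :
    (if P then s else s').nat a = if P then s.nat a else s'.nat a := by split_ifs <;> rfl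

@[simp] theorem State.ite_real (P : Prop) [Decidable P] (s s' : State) (a : ℕ) :
    (if P then s else s').real a = if P then s.real a else s'.real a := by split_ifs <;> rfl

/-! ### Loop-free programs -/

/-- Programs without loops. -/
def Prog.LoopFree : Prog ι → Prop
  | .seq c c' => c.LoopFree ∧ c'.LoopFree
  | .ite _ c c' => c.LoopFree ∧ c'.LoopFree
  | .while _ _ => False
  | _ => True

/-- Time bound for a loop-free program. -/
def Prog.maxCost : Prog ι → ℕ
  | .skip => 1
  | .setReg _ e => e.cost + 1
  | .setNat _ i e => i.cost + e.cost + 1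
  | .setReal _ i e => i.cost + e.cost + 1
  | .seq c c' => c.maxCost + c'.maxCost
  | .ite b c c' => b.cost + 1 + (c.maxCost + c'.maxCost)
  | .while b _ => b.cost

variable (prim) in
open Classical in
/-- The final state of a loop-free program. -/
noncomputable def Prog.run : Prog ι → State → State
  | .skip, s => s
  | .setReg x e, s => s.writeReg x (e.eval s)
  | .setNat a i e, s => s.writeNat a (i.eval s) (e.eval s)
  | .setReal a i e, s => s.writeReal a (i.eval s) (e.eval prim s)
  | .seq c c', s => c'.run (c.run s)
  | .ite b c c', s => if b.Holds prim s then c.run s else c'.run s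
  | .while _ _, s => s

theorem Prog.LoopFree.exists_runs {c : Prog ι} (hc : c.LoopFree) (s : State) :
    ∃ t, Runs prim c s t (c.run prim s) ∧ t ≤ c.maxCost := by
  induction c generalizing s with
  | skip => exact ⟨_, .skip s, le_rfl⟩
  | setReg x e => exact ⟨_, .setReg s x e, le_rfl⟩
  | setNat a i e => exact ⟨_, .setNat s a i e, le_rfl⟩
  | setReal a i e => exact ⟨_, .setReal s a i e, le_rfl⟩
  | seq c c' ih ih' =>
    obtain ⟨t, h, ht⟩ := ih hc.1 s
    obtain ⟨t', h', ht'⟩ := ih' hc.2 (c.run prim s)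
    exact ⟨_, .seq h h', Nat.add_le_add ht ht'⟩
  | ite b c c' ih ih' =>
    by_cases hb : b.Holds prim s
    · obtain ⟨t, h, ht⟩ := ih hc.1 s
      refine ⟨b.cost + 1 + t, ?_, ?_⟩
      · simpa [Prog.run, hb] using Runs.iteTrue (c' := c') hb h
      · simp only [Prog.maxCost]; omega
    · obtain ⟨t, h, ht⟩ := ih' hc.2 s
      refine ⟨b.cost + 1 + t, ?_, ?_⟩
      · simpa [Prog.run, hb] using Runs.iteFalse (c := c) hb h
      · simp only [Prog.maxCost]; omega
  | _ => exact False.elim hc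

theorem Exec.of_loopFree {c : Prog ι} {s : State} {Q : State → Prop} (hc : c.LoopFree)
    (hQ : Q (c.run prim s)) : Exec prim c s c.maxCost Q := by
  obtain ⟨t, h, ht⟩ := hc.exists_runs (prim := prim) s
  exact ⟨t, _, h, ht, hQ⟩

/-! ### Loops -/

/-- Rule for loops with a known number of rounds. The cost of a round may depend on its index, so
that costs proportional to class sizes can be summed instead of being bounded by the worst class. -/
theorem Exec.while_count {b : Test ι} {c : Prog ι} {n : ℕ} {B : ℕ → ℕ} (I : ℕ → State → Prop)
    {s : State} (h0 : I 0 s)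
    (hstep : ∀ k < n, ∀ s, I k s → b.Holds prim s ∧ Exec prim c s (B k) (I (k + 1)))
    (hend : ∀ s, I n s → ¬ b.Holds prim s) :
    Exec prim (.while b c) s ((∑ k ∈ Finset.range n, B k) + (n + 1) * (b.cost + 1)) (I n) := by
  suffices H : ∀ m k, k + m = n → ∀ s, I k s →
      Exec prim (.while b c) s
        ((∑ j ∈ Finset.range m, B (k + j)) + (m + 1) * (b.cost + 1)) (I n) by
    have := H n 0 (zero_add n) s h0
    simp only [zero_add] at this
    exact this
  intro m
  induction m with
  | zero =>
    intro k hk s hs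
    obtain rfl : k = n := by simpa using hk
    exact ⟨_, s, .whileFalse (hend s hs), by simp, hs⟩
  | succ m ih =>
    intro k hk s hs
    obtain ⟨hb, t, s', hr, ht, hs'⟩ := hstep k (by omega) s hs
    obtain ⟨t', s'', hr', ht', hs''⟩ := ih (k + 1) (by omega) s' hs'
    refine ⟨_, s'', .whileTrue hb hr hr', ?_, hs''⟩
    rw [Finset.sum_range_succ', add_zero]
    rw [Finset.sum_congr rfl fun j _ => congrArg B (by omega : k + (j + 1) = k + 1 + j)]
    have : (m + 1 + 1) * (b.cost + 1) = (m + 1) * (b.cost + 1) + (b.cost + 1) := by ring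
    omega

/-- Each round lowers `μ` by at least one, so its initial value bounds the number of rounds. This
serves amortized arguments, where the course of the loop depends on the data. -/
theorem Exec.while_variant {b : Test ι} {c : Prog ι} {B : ℕ} (I : State → Prop)
    (μ : State → ℕ) {s : State} (h0 : I s)
    (hstep : ∀ s, I s → b.Holds prim s → Exec prim c s B (fun s' => I s' ∧ μ s' < μ s)) :
    Exec prim (.while b c) s (μ s * (b.cost + 1 + B) + b.cost + 1)
      (fun s' => I s' ∧ ¬ b.Holds prim s') := by
  induction hm : μ s using Nat.strong_induction_on generalizing s with
  | _ m ih =>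
    by_cases hb : b.Holds prim s
    · obtain ⟨t, s', hr, ht, hI, hlt⟩ := hstep s h0 hb
      obtain ⟨t', s'', hr', ht', hq⟩ := ih (μ s') (hm ▸ hlt) hI rfl
      refine ⟨_, s'', .whileTrue hb hr hr', ?_, hq⟩
      have : (μ s' + 1) * (b.cost + 1 + B) ≤ m * (b.cost + 1 + B) :=
        Nat.mul_le_mul_right _ (by omega)
      rw [add_mul] at this
      omega
    · exact ⟨_, s, .whileFalse hb, by omega, h0, hb⟩

/-! ### Frames -/

/-- The register `x` is assigned somewhere in the program. -/
def Prog.WritesReg (x : ℕ) : Prog ι → Prop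
  | .setReg y _ => x = y
  | .seq c c' => c.WritesReg x ∨ c'.WritesReg x
  | .ite _ c c' => c.WritesReg x ∨ c'.WritesReg x
  | .while _ c => c.WritesReg x
  | _ => False

/-- The natural-number array `a` is assigned somewhere in the program. -/
def Prog.WritesNat (a : ℕ) : Prog ι → Prop
  | .setNat b _ _ => a = b
  | .seq c c' => c.WritesNat a ∨ c'.WritesNat a
  | .ite _ c c' => c.WritesNat a ∨ c'.WritesNat a
  | .while _ c => c.WritesNat a
  | _ => False

/-- The real array `a` is assigned somewhere in the program. -/
def Prog.WritesReal (a : ℕ) : Prog ι → Prop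
  | .setReal b _ _ => a = b
  | .seq c c' => c.WritesReal a ∨ c'.WritesReal a
  | .ite _ c c' => c.WritesReal a ∨ c'.WritesReal a
  | .while _ c => c.WritesReal a
  | _ => False

/-- The states `s` and `s'` agree on all memory that `c` does not assign. -/
structure Frame (c : Prog ι) (s s' : State) : Prop where
  reg : ∀ x, ¬ c.WritesReg x → s'.reg x = s.reg x
  nat : ∀ a, ¬ c.WritesNat a → s'.nat a = s.nat a
  real : ∀ a, ¬ c.WritesReal a → s'.real a = s.real a

theorem Frame.refl (c : Prog ι) (s : State) : Frame c s s :=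
  ⟨fun _ _ => rfl, fun _ _ => rfl, fun _ _ => rfl⟩

theorem Frame.trans {c : Prog ι} {s s' s'' : State} (h : Frame c s s') (h' : Frame c s' s'') :
    Frame c s s'' :=
  ⟨fun x hx => (h'.reg x hx).trans (h.reg x hx), fun x hx => (h'.nat x hx).trans (h.nat x hx),
    fun x hx => (h'.real x hx).trans (h.real x hx)⟩

theorem Frame.mono {c c' : Prog ι} {s s' : State} (h : Frame c s s')
    (hr : ∀ x, c.WritesReg x → c'.WritesReg x) (hn : ∀ x, c.WritesNat x → c'.WritesNat x)
    (hR : ∀ x, c.WritesReal x → c'.WritesReal x) : Frame c' s s' :=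
  ⟨fun x hx => h.reg x (mt (hr x) hx), fun x hx => h.nat x (mt (hn x) hx),
    fun x hx => h.real x (mt (hR x) hx)⟩

/-- What a run preserves can be read off the text of the program. Facts about unassigned memory thus
pass through every subprogram without being part of its specification. -/
theorem Runs.frame {c : Prog ι} {s s' : State} {t : ℕ} (h : Runs prim c s t s') :
    Frame c s s' := by
  induction h with
  | skip s => exact .refl _ _
  | setReg s x e =>
    exact ⟨fun y hy => by simp_all [Prog.WritesReg], fun _ _ => rfl, fun _ _ => rfl⟩
  | setNat s a i e =>
    exact ⟨fun _ _ => rfl, fun y hy => by simp_all [Prog.WritesNat], fun _ _ => rfl⟩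
  | setReal s a i e =>
    exact ⟨fun _ _ => rfl, fun _ _ => rfl, fun y hy => by simp_all [Prog.WritesReal]⟩
  | seq _ _ ih ih' =>
    exact (ih.mono (fun _ => Or.inl) (fun _ => Or.inl) (fun _ => Or.inl)).trans
      (ih'.mono (fun _ => Or.inr) (fun _ => Or.inr) (fun _ => Or.inr))
  | iteTrue _ _ ih => exact ih.mono (fun _ => Or.inl) (fun _ => Or.inl) (fun _ => Or.inl)
  | iteFalse _ _ ih => exact ih.mono (fun _ => Or.inr) (fun _ => Or.inr) (fun _ => Or.inr)
  | whileFalse => exact .refl _ _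
  -- A loop and its body assign the same memory by definition, so the fields of the frame of the
  -- body serve for the loop.
  | whileTrue _ _ _ ih ih' => exact Frame.trans ⟨ih.reg, ih.nat, ih.real⟩ ih'

theorem Exec.frame {c : Prog ι} {s : State} {t : ℕ} {Q : State → Prop} (h : Exec prim c s t Q) :
    Exec prim c s t (fun s' => Q s' ∧ Frame c s s') := by
  obtain ⟨t', s', hr, ht, hq⟩ := h
  exact ⟨t', s', hr, ht, hq, hr.frame⟩

/-! ### Counting loops -/

/-- `for i := 0; i < bound; i++ do c`, with `bound` re-evaluated in every round. -/
def Prog.for (i : ℕ) (bound : NExp) (c : Prog ι) : Prog ι :=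
  .setReg i (.const 0) ;;
    .while (.nlt (.reg i) bound) (c ;; .setReg i (.add (.reg i) (.const 1)))

@[simp] theorem Prog.for_writesReg (i : ℕ) (bound : NExp) (c : Prog ι) (x : ℕ) :
    (Prog.for i bound c).WritesReg x ↔ x = i ∨ c.WritesReg x := by
  simp only [Prog.for, Prog.WritesReg]; tauto

@[simp] theorem Prog.for_writesNat (i : ℕ) (bound : NExp) (c : Prog ι) (x : ℕ) :
    (Prog.for i bound c).WritesNat x ↔ c.WritesNat x := by
  simp only [Prog.for, Prog.WritesNat]; tauto

@[simp] theorem Prog.for_writesReal (i : ℕ) (bound : NExp) (c : Prog ι) (x : ℕ) :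
    (Prog.for i bound c).WritesReal x ↔ c.WritesReal x := by
  simp only [Prog.for, Prog.WritesReal]; tauto

/-- Rule for counting loops: the invariant may not depend on the loop register. -/
theorem Exec.for {i n : ℕ} {bound : NExp} {c : Prog ι} {B : ℕ → ℕ} (I : ℕ → State → Prop)
    {s : State}
    (hbound : ∀ s', Frame (Prog.for i bound c) s s' → bound.eval s' = n)
    (hi : ¬ c.WritesReg i)
    (hI : ∀ k s m, I k s → I k (s.writeReg i m))
    (h0 : I 0 s)
    (hstep : ∀ k < n, ∀ s', Frame (Prog.for i bound c) s s' → s'.reg i = k → I k s' →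
      Exec prim c s' (B k) (I (k + 1))) :
    Exec prim (Prog.for i bound c) s
      ((∑ k ∈ Finset.range n, B k) + n * (bound.cost + 7) + (bound.cost + 5)) (I n) := by
  have hfr : ∀ {s' m}, Frame (Prog.for i bound c) s s' →
      Frame (Prog.for i bound c) s (s'.writeReg i m) := fun h =>
    h.trans ⟨fun x hx => by
      simp only [Prog.for_writesReg, not_or] at hx
      simp [hx.1], fun _ _ => rfl, fun _ _ => rfl⟩
  refine Exec.mono (Exec.seq_of (R := fun s' => (s'.reg i = 0 ∧ Frame (Prog.for i bound c) s s') ∧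
    I 0 s') (t := 2) (t' := (∑ k ∈ Finset.range n, (B k + 4)) +
      (n + 1) * ((Test.nlt (.reg i) bound : Test ι).cost + 1)) (Q := I n)
    ⟨2, _, .setReg _ _ _, le_rfl, ⟨by simp [NExp.eval], hfr (.refl _ _)⟩, hI _ _ _ h0⟩ ?_) ?_
    (fun s' h => h)
  · intro s₁ h₁
    refine (Exec.while_count (fun k s' => (s'.reg i = k ∧ Frame (Prog.for i bound c) s s') ∧
      I k s') h₁ ?_ ?_).mono le_rfl (fun s' h => h.2)
    · rintro k hk s' ⟨⟨hik, hf⟩, hIk⟩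
      refine ⟨by simpa [Test.Holds, NExp.eval, hik, hbound s' hf] using hk, ?_⟩
      refine Exec.seq_of (hstep k hk s' hf hik hIk).frame ?_
      rintro s₂ ⟨h₂, hf₂⟩
      refine ⟨4, _, .setReg _ _ _, le_rfl, ⟨?_, hfr (hf.trans ?_)⟩, hI _ _ _ h₂⟩
      · simp [NExp.eval, hf₂.reg i hi, hik]
      · exact hf₂.mono (by simp +contextual) (by simp +contextual) (by simp +contextual)
    · rintro s' ⟨⟨hik, hf⟩, -⟩
      simp [Test.Holds, NExp.eval, hik, hbound s' hf]
  · simp only [Test.cost, NExp.cost, Finset.sum_add_distrib, Finset.sum_const, Finset.card_range,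
      smul_eq_mul]
    ring_nf
    omega

/-! ### Relocation -/

/-- Move all memory accesses up by `K`. -/
def NExp.shift (K : ℕ) : NExp → NExp
  | .const n => .const n
  | .reg x => .reg (x + K)
  | .load a e => .load (a + K) (e.shift K)
  | .add e e' => .add (e.shift K) (e'.shift K)
  | .sub e e' => .sub (e.shift K) (e'.shift K)

/-- Move all memory accesses up by `K`. -/
def RExp.shift (K : ℕ) : RExp ι → RExp ι
  | .const r => .const r
  | .load a e => .load (a + K) (e.shift K)
  | .ofNat e => .ofNat (e.shift K)
  | .add e e' => .add (e.shift K) (e'.shift K)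
  | .sub e e' => .sub (e.shift K) (e'.shift K)
  | .mul e e' => .mul (e.shift K) (e'.shift K)
  | .div e e' => .div (e.shift K) (e'.shift K)
  | .prim i e => .prim i (e.shift K)

/-- Move all memory accesses up by `K`. -/
def Test.shift (K : ℕ) : Test ι → Test ι
  | .nlt e e' => .nlt (e.shift K) (e'.shift K)
  | .neq e e' => .neq (e.shift K) (e'.shift K)
  | .rlt e e' => .rlt (e.shift K) (e'.shift K)
  | .req e e' => .req (e.shift K) (e'.shift K)
  | .not b => .not (b.shift K)
  | .and b b' => .and (b.shift K) (b'.shift K)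

/-- Move all memory accesses up by `K`. -/
def Prog.shift (K : ℕ) : Prog ι → Prog ι
  | .skip => .skip
  | .setReg x e => .setReg (x + K) (e.shift K)
  | .setNat a i e => .setNat (a + K) (i.shift K) (e.shift K)
  | .setReal a i e => .setReal (a + K) (i.shift K) (e.shift K)
  | .seq c c' => .seq (c.shift K) (c'.shift K)
  | .ite b c c' => .ite (b.shift K) (c.shift K) (c'.shift K)
  | .while b c => .while (b.shift K) (c.shift K)

/-- The memory from number `K` on. -/
def State.view (K : ℕ) (s : State) : State :=
  ⟨fun x => s.reg (x + K), fun a => s.nat (a + K), fun a => s.real (a + K)⟩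

theorem NExp.eval_shift (K : ℕ) (s : State) (e : NExp) :
    (e.shift K).eval s = e.eval (s.view K) := by
  induction e <;> simp_all [NExp.shift, NExp.eval, State.view]

theorem NExp.cost_shift (K : ℕ) (e : NExp) : (e.shift K).cost = e.cost := by
  induction e <;> simp_all [NExp.shift, NExp.cost]

theorem RExp.eval_shift (K : ℕ) (s : State) (e : RExp ι) :
    (e.shift K).eval prim s = e.eval prim (s.view K) := by
  induction e <;> simp_all [RExp.shift, RExp.eval, NExp.eval_shift]
  simp [State.view]

theorem RExp.cost_shift (K : ℕ) (e : RExp ι) : (e.shift K).cost = e.cost := by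
  induction e <;> simp_all [RExp.shift, RExp.cost, NExp.cost_shift]

theorem Test.holds_shift (K : ℕ) (s : State) (b : Test ι) :
    (b.shift K).Holds prim s ↔ b.Holds prim (s.view K) := by
  induction b <;> simp_all [Test.shift, Test.Holds, NExp.eval_shift, RExp.eval_shift]

theorem Test.cost_shift (K : ℕ) (b : Test ι) : (b.shift K).cost = b.cost := by
  induction b <;> simp_all [Test.shift, Test.cost, NExp.cost_shift, RExp.cost_shift]

/-- The relocated program simulates the original on the upper part of the memory, step by step and
at equal cost. Arbitrary initial contents are harmless, since any state `s` with the right view will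
do. -/
theorem Runs.shift (K : ℕ) {c : Prog ι} {v v' : State} {t : ℕ} (h : Runs prim c v t v') :
    ∀ s, s.view K = v → ∃ s', Runs prim (c.shift K) s t s' ∧ s'.view K = v' := by
  induction h with
  | skip v => exact fun s hs => ⟨s, .skip s, hs⟩
  | setReg v x e =>
    rintro s rfl
    have h := Runs.setReg (prim := prim) s (x + K) (e.shift K)
    rw [NExp.cost_shift] at h
    refine ⟨_, h, ?_⟩
    simp [State.view, State.writeReg, NExp.eval_shift, Function.update_apply, funext_iff]
  | setNat v a i e =>
    rintro s rfl
    have h := Runs.setNat (prim := prim) s (a + K) (i.shift K) (e.shift K)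
    rw [NExp.cost_shift, NExp.cost_shift] at h
    refine ⟨_, h, ?_⟩
    simp [State.view, State.writeNat, NExp.eval_shift, Function.update_apply, funext_iff]
  | setReal v a i e =>
    rintro s rfl
    have h := Runs.setReal (prim := prim) s (a + K) (i.shift K) (e.shift K)
    rw [NExp.cost_shift, RExp.cost_shift] at h
    refine ⟨_, h, ?_⟩
    simp [State.view, State.writeReal, NExp.eval_shift, RExp.eval_shift, Function.update_apply,
      funext_iff]
  | seq _ _ ih ih' =>
    intro s hs
    obtain ⟨s₁, h₁, hs₁⟩ := ih s hs
    obtain ⟨s₂, h₂, hs₂⟩ := ih' s₁ hs₁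
    exact ⟨s₂, .seq h₁ h₂, hs₂⟩
  | iteTrue hb _ ih =>
    rintro s rfl
    obtain ⟨s₁, h₁, hs₁⟩ := ih s rfl
    refine ⟨s₁, ?_, hs₁⟩
    rw [← Test.cost_shift K]
    exact .iteTrue ((Test.holds_shift K s _).2 hb) h₁
  | iteFalse hb _ ih =>
    rintro s rfl
    obtain ⟨s₁, h₁, hs₁⟩ := ih s rfl
    refine ⟨s₁, ?_, hs₁⟩
    rw [← Test.cost_shift K]
    exact .iteFalse (fun h => hb ((Test.holds_shift K s _).1 h)) h₁
  | whileFalse hb =>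
    rintro s rfl
    refine ⟨s, ?_, rfl⟩
    rw [← Test.cost_shift K]
    exact .whileFalse (fun h => hb ((Test.holds_shift K s _).1 h))
  | whileTrue hb _ _ ih ih' =>
    rintro s rfl
    obtain ⟨s₁, h₁, hs₁⟩ := ih s rfl
    obtain ⟨s₂, h₂, hs₂⟩ := ih' s₁ hs₁
    refine ⟨s₂, ?_, hs₂⟩
    rw [← Test.cost_shift K]
    exact .whileTrue ((Test.holds_shift K s _).2 hb) h₁ h₂

/-- With this and its two companions below, nothing about an unknown program is needed to know that
its relocated copy spares the memory of the caller. -/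
theorem Prog.shift_writesReg_lt {K x : ℕ} (hx : x < K) (c : Prog ι) :
    ¬ (c.shift K).WritesReg x := by
  induction c <;> simp_all [Prog.shift, Prog.WritesReg]
  omega

theorem Prog.shift_writesNat_lt {K x : ℕ} (hx : x < K) (c : Prog ι) :
    ¬ (c.shift K).WritesNat x := by
  induction c <;> simp_all [Prog.shift, Prog.WritesNat]
  omega

theorem Prog.shift_writesReal_lt {K x : ℕ} (hx : x < K) (c : Prog ι) :
    ¬ (c.shift K).WritesReal x := by
  induction c <;> simp_all [Prog.shift, Prog.WritesReal]
  omega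

end RealRAM

/-! ### Degree sums in forests and distances in trees -/

open Finset in
-- A forest on `A` has at most `#A - 1` edges, since it extends to a tree on `A`, and the degrees
-- count every edge twice.
theorem SimpleGraph.IsAcyclic.sum_card_adj_add_two_le {V : Type*} [Fintype V] [DecidableEq V]
    {G : SimpleGraph V} [DecidableRel G.Adj] (hG : G.IsAcyclic) {A : Finset V}
    (hA : A.Nonempty) : ∑ u ∈ A, #{x ∈ A | G.Adj u x} + 2 ≤ 2 * #A := by
  classical
  have hac : (G.induce (A : Set V)).IsAcyclic := hG.induce _
  have : Nonempty (A : Set V) := hA.to_subtype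
  obtain ⟨T, hT, -, hle⟩ := SimpleGraph.connected_top.exists_isTree_le_of_le_of_isAcyclic
    (le_top : G.induce (A : Set V) ≤ ⊤) hac
  have h1 := hle.card_edgeFinset
  have h2 : #(G.induce (A : Set V)).edgeFinset ≤ #T.edgeFinset :=
    card_le_card (SimpleGraph.edgeFinset_mono ‹_›)
  have h3 := (G.induce (A : Set V)).sum_degrees_eq_twice_card_edges
  have h4 : ∑ u ∈ A, #{x ∈ A | G.Adj u x} = ∑ u : (A : Set V), (G.induce (A : Set V)).degree u := by
    rw [← Finset.sum_coe_sort A]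
    refine Finset.sum_congr rfl fun u _ => ?_
    rw [← SimpleGraph.card_neighborFinset_eq_degree]
    refine Finset.card_bij' (fun x hx => ⟨x, (mem_filter.1 hx).1⟩) (fun x _ => x.1) ?_ ?_ ?_ ?_
    all_goals simp
  have h5 : Fintype.card (A : Set V) = #A := by simp
  omega

/-- Paths in a tree are unique, so the infimum ranges over one element. -/
theorem weightedDist_eq_of_isPath {V : Type*} {G : SimpleGraph V} (hG : G.IsTree)
    (w : Sym2 V → ℝ) {u v : V} (p : G.Walk u v) (hp : p.IsPath) :
    weightedDist G w u v = (p.edges.map w).sum := by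
  have : Unique (G.Path u v) := ⟨⟨⟨p, hp⟩⟩, fun _ => (hG.isAcyclic.subsingleton_path u v).elim _ _⟩
  rw [weightedDist, ciInf_unique]
  congr 2
  rw [Subsingleton.elim (default : G.Path u v) ⟨p, hp⟩]

/-! ### Peeling off leaves down to the centroids -/

section Peeling

variable {N : ℕ}

open Finset

open Classical in
/-- The neighbours of `u` with the same label that are not in `R`. -/
noncomputable def labelNbs (G : SimpleGraph (Fin N)) (lab : Fin N → Fin N) (R : List (Fin N))
    (u : Fin N) : Finset (Fin N) :=
  {x | x ∉ R ∧ G.Adj u x ∧ lab x = lab u}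

theorem mem_labelNbs {G : SimpleGraph (Fin N)} {lab : Fin N → Fin N} {R : List (Fin N)}
    {u x : Fin N} : x ∈ labelNbs G lab R u ↔ x ∉ R ∧ G.Adj u x ∧ lab x = lab u := by
  simp [labelNbs]

/-- Every label class spans at least as many edges as a tree on it has. -/
def SpansTrees (G : SimpleGraph (Fin N)) (lab : Fin N → Fin N) : Prop :=
  ∀ u, 2 * #{x | lab x = lab u} ≤ ∑ x with lab x = lab u, #(labelNbs G lab [] x) + 2

/-- Every label class is peeled leaf by leaf; `R` lists the vertices removed so far, the last one
first. `deg`, `ns` and `ws` are the number, the sum and the sum of edge weights of the remaining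
neighbours of the same label, `par` points from a removed vertex to its last neighbour, across an edge
of weight `pw`, and `acc` counts the vertices that have been merged into a vertex. -/
structure Peeling (G : SimpleGraph (Fin N)) (w : Sym2 (Fin N) → ℝ) (lab : Fin N → Fin N)
    (R : List (Fin N)) (deg ns acc : Fin N → ℕ) (ws pw : Fin N → ℝ) (par : Fin N → Fin N) :
    Prop where
  deg_eq : ∀ u ∉ R, deg u = #(labelNbs G lab R u)
  ns_eq : ∀ u ∉ R, ns u = ∑ x ∈ labelNbs G lab R u, (x : ℕ)
  ws_eq : ∀ u ∉ R, ws u = ∑ x ∈ labelNbs G lab R u, w s(u, x)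
  deg_removed : ∀ u ∈ R, deg u = 0
  par_self : ∀ u ∉ R, par u = u
  par_adj : ∀ u ∈ R, G.Adj u (par u)
  par_lab : ∀ u ∈ R, lab (par u) = lab u
  pw_eq : ∀ u ∈ R, pw u = w s(u, par u)
  light : ∀ u ∈ R, 2 * acc u ≤ #{x | lab x = lab u}
  acc_eq : ∀ u, acc u = 1 + ∑ x with x ∈ R ∧ par x = u, acc x
  spans : ∀ u, 2 * #{x | x ∉ R ∧ lab x = lab u} ≤ ∑ x with x ∉ R ∧ lab x = lab u, deg x + 2
  order : R.Pairwise fun v x => par v ≠ x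
  nodup : R.Nodup

namespace Peeling

variable {G : SimpleGraph (Fin N)} {w : Sym2 (Fin N) → ℝ} {lab : Fin N → Fin N}
  {R : List (Fin N)} {deg ns acc : Fin N → ℕ} {ws pw : Fin N → ℝ} {par : Fin N → Fin N}

/-- `pw` is arbitrary because it matters only at removed vertices; its array is never initialized.
-/
theorem init (hspan : SpansTrees G lab) (pw : Fin N → ℝ) :
    Peeling G w lab [] (fun u => #(labelNbs G lab [] u))
      (fun u => ∑ x ∈ labelNbs G lab [] u, (x : ℕ)) (fun _ => 1)
      (fun u => ∑ x ∈ labelNbs G lab [] u, w s(u, x)) pw id where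
  deg_eq _ _ := rfl
  ns_eq _ _ := rfl
  ws_eq _ _ := rfl
  deg_removed u hu := absurd hu List.not_mem_nil
  par_self _ _ := rfl
  par_adj u hu := absurd hu List.not_mem_nil
  par_lab u hu := absurd hu List.not_mem_nil
  pw_eq u hu := absurd hu List.not_mem_nil
  light u hu := absurd hu List.not_mem_nil
  acc_eq u := by simp
  spans u := by simpa using hspan u
  order := .nil
  nodup := .nil

/-- A sum over a one-element set is its element: at a leaf, `ns` is the neighbour and `ws` is the
weight of the edge to it. -/
theorem exists_parent (h : Peeling G w lab R deg ns acc ws pw par) {v : Fin N}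
    (hv : deg v = 1) : v ∉ R ∧ ∃ p : Fin N, p ∉ R ∧ p ≠ v ∧ G.Adj v p ∧ lab p = lab v ∧
      labelNbs G lab R v = {p} ∧ ns v = p ∧ ws v = w s(v, p) := by
  have hvR : v ∉ R := fun hR => by simp [h.deg_removed v hR] at hv
  refine ⟨hvR, ?_⟩
  obtain ⟨p, hp⟩ := card_eq_one.1 ((h.deg_eq v hvR).symm.trans hv)
  have hpm : p ∈ labelNbs G lab R v := by simp [hp]
  obtain ⟨hpR, hadj, hlab⟩ := mem_labelNbs.1 hpm
  refine ⟨p, hpR, hadj.ne', hadj, hlab, hp, ?_, ?_⟩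
  · simp [h.ns_eq v hvR, hp]
  · simp [h.ws_eq v hvR, hp]

/-- By symmetry of adjacency, a leaf is missed only by its own neighbour. -/
theorem labelNbs_cons_of_ne {v p u : Fin N} (hp : labelNbs G lab R v = {p})
    (hu : u ∉ R) (hup : u ≠ p) : labelNbs G lab (v :: R) u = labelNbs G lab R u := by
  ext x
  simp only [mem_labelNbs, List.mem_cons, not_or]
  refine ⟨fun ⟨⟨_, a⟩, b⟩ => ⟨a, b⟩, fun ⟨a, b, c⟩ => ⟨⟨?_, a⟩, b, c⟩⟩
  rintro rfl
  have : u ∈ labelNbs G lab R x := mem_labelNbs.2 ⟨hu, b.symm, c.symm⟩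
  simp [hp, hup] at this

theorem labelNbs_cons_parent {v p : Fin N} :
    labelNbs G lab (v :: R) p = (labelNbs G lab R p).erase v := by
  ext x
  simp only [mem_labelNbs, List.mem_cons, not_or, mem_erase]
  tauto

/-- Removing the leaf `v` affects only the data of `v` and of its neighbour `p`. The order condition
survives because `p` has not been removed. -/
theorem step (h : Peeling G w lab R deg ns acc ws pw par) {v p : Fin N}
    (hdv : deg v = 1) (hlight : 2 * acc v ≤ #{x | lab x = lab v}) (hvR : v ∉ R) (hpR : p ∉ R)
    (hpv : p ≠ v) (hadj : G.Adj v p) (hlab : lab p = lab v) (hp : labelNbs G lab R v = {p}) :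
    Peeling G w lab (v :: R) (Function.update (Function.update deg v 0) p (deg p - 1))
      (Function.update ns p (ns p - v)) (Function.update acc p (acc p + acc v))
      (Function.update ws p (ws p - w s(v, p))) (Function.update pw v (w s(v, p)))
      (Function.update par v p) := by
  have hvp : v ∈ labelNbs G lab R p := mem_labelNbs.2 ⟨hvR, hadj.symm, hlab.symm⟩
  have hdp : 1 ≤ deg p := by
    rw [h.deg_eq p hpR]; exact card_pos.2 ⟨v, hvp⟩
  have hpc : p ∉ v :: R := by simp [hpv, hpR]
  have hne : ∀ {u}, u ∈ v :: R → u ≠ p := fun hu hup => hpc (hup ▸ hu)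
  constructor
  · intro u hu
    simp only [List.mem_cons, not_or] at hu
    rcases eq_or_ne u p with rfl | hup
    · simp [labelNbs_cons_parent, card_erase_of_mem hvp, h.deg_eq u hpR]
    · simp [hup, hu.1, labelNbs_cons_of_ne hp hu.2 hup, h.deg_eq u hu.2]
  · intro u hu
    simp only [List.mem_cons, not_or] at hu
    rcases eq_or_ne u p with rfl | hup
    -- The truncated subtraction is exact, since `v` is one of the summands.
    · have := Finset.add_sum_erase _ (fun x : Fin N => (x : ℕ)) hvp
      simp only [Function.update_self, labelNbs_cons_parent, h.ns_eq u hpR]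
      omega
    · simp [hup, labelNbs_cons_of_ne hp hu.2 hup, h.ns_eq u hu.2]
  · intro u hu
    simp only [List.mem_cons, not_or] at hu
    rcases eq_or_ne u p with rfl | hup
    · have := Finset.add_sum_erase _ (fun x : Fin N => w s(u, x)) hvp
      simp only [Function.update_self, labelNbs_cons_parent, h.ws_eq u hpR]
      rw [Sym2.eq_swap]
      linarith
    · simp [hup, labelNbs_cons_of_ne hp hu.2 hup, h.ws_eq u hu.2]
  · intro u hu
    rw [Function.update_of_ne (hne hu)]
    rcases List.mem_cons.1 hu with rfl | hu
    · simp
    · rw [Function.update_apply]; split_ifs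
      · rfl
      · exact h.deg_removed u hu
  · intro u hu
    simp only [List.mem_cons, not_or] at hu
    simp [hu.1, h.par_self u hu.2]
  · intro u hu
    rcases eq_or_ne u v with rfl | huv
    · simpa using hadj
    · simpa [huv] using h.par_adj u (by simpa [huv] using hu)
  · intro u hu
    rcases eq_or_ne u v with rfl | huv
    · simpa using hlab
    · simpa [huv] using h.par_lab u (by simpa [huv] using hu)
  · intro u hu
    rcases eq_or_ne u v with rfl | huv
    · simp
    · simpa [huv] using h.pw_eq u (by simpa [huv] using hu)
  · intro u hu
    rw [Function.update_of_ne (hne hu)]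
    rcases eq_or_ne u v with rfl | huv
    · exact hlight
    · exact h.light u (by simpa [huv] using hu)
  · intro u
    -- The set of vertices merged into `p` gains exactly `v`. The summands keep their values because
    -- `p`, whose `acc` changes, is not removed.
    have hsum : ∑ x with x ∈ v :: R ∧ Function.update par v p x = u,
        Function.update acc p (acc p + acc v) x
        = ∑ x with x ∈ R ∧ par x = u, acc x + if u = p then acc v else 0 := by
      have e1 : ∑ x with x ∈ v :: R ∧ Function.update par v p x = u,
          Function.update acc p (acc p + acc v) x =
          ∑ x with x ∈ v :: R ∧ Function.update par v p x = u, acc x := by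
        refine Finset.sum_congr rfl fun x hx => ?_
        rw [Function.update_of_ne (hne (mem_filter.1 hx).2.1)]
      rw [e1]
      split_ifs with hup
      · subst hup
        have : Finset.univ.filter (fun x => x ∈ v :: R ∧ Function.update par v u x = u) =
            insert v (Finset.univ.filter fun x => x ∈ R ∧ par x = u) := by
          ext x
          rcases eq_or_ne x v with rfl | hx <;> simp [*]
        rw [this, sum_insert (by simp [hvR]), add_comm]
      · rw [add_zero]
        refine Finset.sum_congr ?_ fun _ _ => rfl
        ext x
        rcases eq_or_ne x v with rfl | hx
        · simp [hvR, Ne.symm hup]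
        · simp [hx]
    rw [hsum]
    rcases eq_or_ne u p with rfl | hup
    · rw [if_pos rfl, Function.update_self, h.acc_eq u]; ring
    · rw [if_neg hup, Function.update_of_ne hup, h.acc_eq u, add_zero]
  · intro u
    have hset : ({x | x ∉ v :: R ∧ lab x = lab u} : Finset (Fin N)) =
        ({x | x ∉ R ∧ lab x = lab u} : Finset (Fin N)).erase v := by
      ext x; simp; tauto
    have hs := h.spans u
    rw [hset]
    set A : Finset (Fin N) := {x | x ∉ R ∧ lab x = lab u} with hA
    by_cases hl : lab v = lab u
    -- One vertex less lowers the left side by 2. The degree sum also drops by 2: the degree 1 of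
    -- `v`, and 1 at `p`.
    · have hvA : v ∈ A := by simp [hA, hvR, hl]
      have hpA : p ∈ A.erase v := by simp [hA, hpR, hlab, hl, hpv]
      rw [← add_sum_erase _ _ hpA, Function.update_self, card_erase_of_mem hvA]
      rw [← add_sum_erase _ _ hvA, ← add_sum_erase _ _ hpA, hdv] at hs
      have : ∑ x ∈ (A.erase v).erase p, Function.update (Function.update deg v 0) p (deg p - 1) x
          = ∑ x ∈ (A.erase v).erase p, deg x := by
        refine Finset.sum_congr rfl fun x hx => ?_
        simp only [mem_erase] at hx
        simp [hx.1, hx.2.1]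
      rw [this]
      omega
    · have hvA : v ∉ A := by simp [hA, hl]
      have hpA : p ∉ A := by simp [hA, hlab, hl]
      rw [erase_eq_of_notMem hvA]
      rw [Finset.sum_congr rfl fun x hx => ?_]
      · exact hs
      · rw [Function.update_of_ne (fun e : x = p => hpA (e ▸ hx)),
          Function.update_of_ne (fun e : x = v => hvA (e ▸ hx))]
  · refine List.pairwise_cons.2 ⟨fun x hx => ?_, ?_⟩
    · simpa using fun e : p = x => hpR (e ▸ hx)
    · refine h.order.imp_of_mem fun {a b} ha hb hab => ?_
      rwa [Function.update_of_ne (fun e : a = v => hvR (e ▸ ha))]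
  · exact List.nodup_cons.2 ⟨hvR, h.nodup⟩

/-- Vertices that were removed earlier are ranked higher. -/
theorem exists_rank (h : Peeling G w lab R deg ns acc ws pw par) :
    ∃ ρ : Fin N → ℕ, ∀ u ∈ R, ρ (par u) < ρ u := by
  refine ⟨fun u => if u ∈ R then R.idxOf u + 1 else 0, fun u hu => ?_⟩
  by_cases hp : par u ∈ R
  · simp only [hp, hu, if_true, add_lt_add_iff_right]
    have hu' := List.idxOf_lt_length_of_mem hu
    have hp' := List.idxOf_lt_length_of_mem hp
    rcases lt_trichotomy (R.idxOf (par u)) (R.idxOf u) with hlt | heq | hgt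
    · exact hlt
    · exact absurd ((List.idxOf_inj hp).1 heq) (h.par_adj u hu).ne'
    · have := List.pairwise_iff_getElem.1 h.order _ _ hu' hp' hgt
      simp at this
  · simp [hp, hu]

/-- The vertices of `A` outside `B` are isolated in the remaining graph, so all remaining edges of
the class lie within `B`, where the bound for forests applies. -/
theorem spans_class (h : Peeling G w lab R deg ns acc ws pw par) (hG : G.IsAcyclic)
    {A : Finset (Fin N)} {c : Fin N} (hA : ∀ x, x ∈ A ↔ x ∉ R ∧ lab x = c) :
    ∀ B ⊆ A, B.Nonempty → (∀ u ∈ A, u ∉ B → deg u = 0) → ∑ x ∈ A, deg x + 2 ≤ 2 * #B := by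
  classical
  intro B hB hne h0
  refine le_trans (Nat.add_le_add_right ?_ 2) (hG.sum_card_adj_add_two_le hne)
  rw [← Finset.sum_subset hB h0]
  refine Finset.sum_le_sum fun u hu => ?_
  obtain ⟨huR, hul⟩ := (hA u).1 (hB hu)
  rw [h.deg_eq u huR]
  refine card_le_card fun x hx => ?_
  obtain ⟨hxR, hadj, hxl⟩ := mem_labelNbs.1 hx
  refine mem_filter.2 ⟨?_, hadj⟩
  by_contra hxB
  have := h0 x ((hA x).2 ⟨hxR, hxl.trans hul⟩) hxB
  rw [h.deg_eq x hxR, card_eq_zero] at this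
  have hmem : u ∈ labelNbs G lab R x := mem_labelNbs.2 ⟨huR, hadj.symm, hxl.symm⟩
  simp [this] at hmem

/-- Summing the recursion of `acc` over `Z` makes it telescope, provided the vertices merged into
`Z` are those of `Z \ B`: all weight of `Z` ends up in `B`. It is applied to whole classes with
their remaining vertices, and to branches with their top vertex. -/
theorem sum_acc (h : Peeling G w lab R deg ns acc ws pw par) {Z B : Finset (Fin N)}
    (hB : B ⊆ Z) (hpar : ∀ x ∈ R, par x ∈ Z ↔ x ∈ Z \ B) (hR : ∀ x ∈ Z \ B, x ∈ R) :
    ∑ x ∈ B, acc x = #Z := by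
  have h1 : ∑ x ∈ Z, acc x = #Z + ∑ u ∈ Z, ∑ x with x ∈ R ∧ par x = u, acc x := by
    rw [Finset.sum_congr rfl fun u _ => h.acc_eq u, Finset.sum_add_distrib]; simp
  have h2 : ∑ u ∈ Z, ∑ x with x ∈ R ∧ par x = u, acc x = ∑ x ∈ Z \ B, acc x := by
    rw [← Finset.sum_biUnion]
    · refine Finset.sum_congr ?_ fun _ _ => rfl
      ext x
      simp only [mem_biUnion, mem_filter, mem_univ, true_and]
      constructor
      · rintro ⟨u, hu, hxR, rfl⟩; exact (hpar x hxR).1 hu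
      · intro hx; exact ⟨_, (hpar x (hR x hx)).2 hx, hR x hx, rfl⟩
    · intro a _ b _ hab
      refine Finset.disjoint_left.2 fun x hx hx' => hab ?_
      simp only [mem_filter] at hx hx'
      exact hx.2.2.symm.trans hx'.2.2
  have := Finset.sum_sdiff hB (f := acc)
  omega

/-- Two remaining vertices would leave a tree with at least two leaves. As neither can be removed,
each carries more than half of the class, but together they carry at most the whole of it. -/
theorem alive_unique (h : Peeling G w lab R deg ns acc ws pw par) (hG : G.IsAcyclic)
    (hstuck : ∀ u, deg u = 1 → #{x | lab x = lab u} < 2 * acc u) {u v : Fin N}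
    (hu : u ∉ R) (hv : v ∉ R) (hl : lab u = lab v) : u = v := by
  by_contra huv
  set A : Finset (Fin N) := {x | x ∉ R ∧ lab x = lab u} with hAdef
  have hA : ∀ x, x ∈ A ↔ x ∉ R ∧ lab x = lab u := fun x => by simp [hAdef]
  have huA : u ∈ A := by simp [hA, hu]
  have hvA : v ∈ A := by simp [hA, hv, hl]
  have hspan := h.spans u
  rw [← hAdef] at hspan
  have hup := h.spans_class hG hA
  -- Without an isolated vertex `x`, the edges would form a forest on one vertex less, which has too
  -- few edges for `hspan`.
  have hpos : ∀ x ∈ A, 1 ≤ deg x := by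
    intro x hx
    by_contra h0
    have := hup (A.erase x) (erase_subset _ _) ?_ ?_
    · have h1 := card_erase_add_one hx
      omega
    · rcases eq_or_ne x u with rfl | hxu
      · exact ⟨v, mem_erase.2 ⟨Ne.symm huv, hvA⟩⟩
      · exact ⟨u, mem_erase.2 ⟨Ne.symm hxu, huA⟩⟩
    · intro y hy hy'
      simp only [mem_erase, not_and, hy, not_true, imp_false, not_not] at hy'
      subst hy'; omega
  have hle := hup A subset_rfl ⟨u, huA⟩ (fun x hx hx' => absurd hx hx')
  -- The degrees sum to at most `2 * #A - 2`, and every vertex that is not a leaf contributes at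
  -- least 2.
  have htwo : 2 ≤ #(A.filter fun x => deg x = 1) := by
    have h1 : ∑ x ∈ A, (2 - (if deg x = 1 then 1 else 0)) ≤ ∑ x ∈ A, deg x := by
      refine Finset.sum_le_sum fun x hx => ?_
      have := hpos x hx
      split_ifs <;> omega
    have h2 : ∑ x ∈ A, (2 - (if deg x = 1 then 1 else 0)) + #(A.filter fun x => deg x = 1)
        = 2 * #A := by
      rw [card_filter, ← Finset.sum_add_distrib, mul_comm, ← smul_eq_mul, ← Finset.sum_const]
      refine Finset.sum_congr rfl fun x _ => ?_
      split_ifs <;> rfl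
    omega
  obtain ⟨a, ha, b, hb, hab⟩ := one_lt_card.1 htwo
  simp only [mem_filter] at ha hb
  have hsum := h.sum_acc (Z := {x | lab x = lab u}) (B := A) ?_ ?_ ?_
  · have h1 : acc a + acc b ≤ ∑ x ∈ A, acc x := by
      rw [← sum_pair hab]
      exact sum_le_sum_of_subset (by simp [insert_subset_iff, ha.1, hb.1])
    have h2 := hstuck a ha.2
    have h3 := hstuck b hb.2
    rw [((hA a).1 ha.1).2] at h2
    rw [((hA b).1 hb.1).2] at h3
    omega
  · intro x hx; simpa using ((hA x).1 hx).2
  · intro x hx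
    simp [hA, h.par_lab x hx, hx]
  · intro x hx
    simp only [mem_filter, mem_univ, true_and, Finset.mem_sdiff, hA, not_and] at hx
    by_contra hxR
    exact hx.2 hxR hx.1

end Peeling

/-- The classes of `lab` are split into the classes of `nl` by the removal of one vertex from each class
of `lab`, at distance `h u` from `u`; a removed vertex is a class of its own. -/
structure IsHalving (G : SimpleGraph (Fin N)) (w : Sym2 (Fin N) → ℝ) (lab nl : Fin N → Fin N)
    (h : Fin N → ℝ) : Prop where
  lab_eq : ∀ u v, nl u = nl v → lab u = lab v
  card_le : ∀ u, #{x | nl x = nl u} ≤ max 1 (#{x | lab x = lab u} / 2)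
  spans : SpansTrees G nl
  dist_eq : ∀ u v, lab u = lab v → nl u ≠ nl v → weightedDist G w u v = h u + h v

/-- The parent pointers make each class a tree hanging from its survivor. `h` is the length of the
way up, and `nl` names the topmost removed vertex on that way, so the classes of `nl` are the
branches and the survivors. -/
theorem Peeling.isHalving {G : SimpleGraph (Fin N)} {w : Sym2 (Fin N) → ℝ} {lab : Fin N → Fin N}
    {R : List (Fin N)} {deg ns acc : Fin N → ℕ} {ws pw : Fin N → ℝ} {par : Fin N → Fin N}
    (hP : Peeling G w lab R deg ns acc ws pw par) (hG : G.IsTree)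
    (hstuck : ∀ u, deg u = 1 → #{x | lab x = lab u} < 2 * acc u)
    {h : Fin N → ℝ} {nl : Fin N → Fin N} (h_root : ∀ u ∉ R, h u = 0) (nl_root : ∀ u ∉ R, nl u = u)
    (h_par : ∀ u ∈ R, h u = h (par u) + pw u)
    (nl_par : ∀ u ∈ R, nl u = if par u ∈ R then nl (par u) else u) :
    IsHalving G w lab nl h := by
  obtain ⟨ρ, hρ⟩ := hP.exists_rank
  -- Induction along the parent pointers, which is well founded by the rank.
  have hind : ∀ {p : Fin N → Prop}, (∀ u, (u ∈ R → p (par u)) → p u) → ∀ u, p u := by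
    intro p hp u
    induction hk : ρ u using Nat.strong_induction_on generalizing u with
    | _ k ih => exact hp u fun hu => ih _ (hk ▸ hρ u hu) _ rfl
  have hlab : ∀ u, lab (nl u) = lab u := hind fun u ih => by
    by_cases hu : u ∈ R
    · rw [nl_par u hu]
      split_ifs with hpu
      · rw [ih hu, hP.par_lab u hu]
      · rfl
    · rw [nl_root u hu]
  -- The label of a removed vertex is the top of its branch: a removed vertex with a surviving
  -- parent.
  have htop : ∀ u, u ∈ R → nl u ∈ R ∧ par (nl u) ∉ R ∧ nl (nl u) = nl u := hind fun u ih hu => by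
    rw [nl_par u hu]
    split_ifs with hpu
    · exact ih hu hpu
    · exact ⟨hu, hpu, by rw [nl_par u hu, if_neg hpu]⟩
  have hchild : ∀ {t}, t ∈ R → par t ∉ R → ∀ x ∈ R, nl (par x) = t ↔ nl x = t ∧ x ≠ t := by
    intro t ht hpt x hx
    rw [nl_par x hx]
    split_ifs with hpx
    · refine ⟨fun e => ⟨e, ?_⟩, And.left⟩
      rintro rfl
      exact hpt hpx
    · rw [nl_root _ hpx]
      exact ⟨fun e => absurd (e ▸ ht) hpx, fun e => absurd e.1 e.2⟩
  have hmemR : ∀ {x t}, nl x = t → t ∈ R → x ∈ R := by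
    rintro x t rfl ht
    by_contra hx
    rw [nl_root x hx] at ht
    exact hx ht
  have hsing : ∀ u ∉ R, ({x | nl x = nl u} : Finset (Fin N)) = {u} := by
    intro u hu
    ext x
    simp only [mem_filter, mem_univ, true_and, mem_singleton, nl_root u hu]
    refine ⟨fun e => ?_, fun e => e ▸ nl_root u hu⟩
    by_cases hx : x ∈ R
    · exact absurd (e ▸ (htop x hx).1) hu
    · rwa [nl_root x hx] at e
  -- The pointers trace a walk to a survivor that stays within the branch before its end. The bound
  -- on the ranks makes it a path.
  have hpath : ∀ u, ∃ (c : Fin N) (p : G.Walk u c), c ∉ R ∧ lab c = lab u ∧ p.IsPath ∧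
      (p.edges.map w).sum = h u ∧
      ∀ x ∈ p.support, ρ x ≤ ρ u ∧ (x = c ∨ u ∈ R ∧ nl x = nl u) := hind fun u ih => by
    by_cases hu : u ∈ R
    · obtain ⟨c, p, hc, hl, hp, hs, hx⟩ := ih hu
      refine ⟨c, .cons (hP.par_adj u hu) p, hc, hl.trans (hP.par_lab u hu), ?_, ?_, ?_⟩
      · refine hp.cons fun hmem => ?_
        exact absurd (hx u hmem).1 (not_le.2 (hρ u hu))
      · simp [hs, h_par u hu, hP.pw_eq u hu, add_comm]
      · intro x hmem
        rw [SimpleGraph.Walk.support_cons, List.mem_cons] at hmem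
        rcases hmem with rfl | hmem
        · exact ⟨le_rfl, .inr ⟨hu, rfl⟩⟩
        · refine ⟨(hx x hmem).1.trans (hρ u hu).le, (hx x hmem).2.imp_right fun ⟨h1, h2⟩ => ⟨hu, ?_⟩⟩
          rw [h2, nl_par u hu, if_pos h1]
    · exact ⟨u, .nil, hu, rfl, .nil, by simp [h_root u hu], by simp⟩
  constructor
  · intro u v huv
    rw [← hlab u, huv, hlab]
  · intro u
    by_cases hu : u ∈ R
    · obtain ⟨ht, hpt, htt⟩ := htop u hu
      -- All weight of a branch is collected in its top vertex, which was light when it was removed.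
      have := hP.sum_acc (Z := {x | nl x = nl u}) (B := {nl u}) (by simpa using htt)
        (fun x hx => by simpa using hchild ht hpt x hx)
        (fun x hx => hmemR (by simp at hx; exact hx.1) ht)
      rw [sum_singleton] at this
      have h2 := hP.light _ ht
      rw [hlab] at h2
      exact le_max_of_le_right (by omega)
    · simp [hsing u hu]
  · intro u
    by_cases hu : u ∈ R
    · obtain ⟨ht, hpt, htt⟩ := htop u hu
      set t := nl u with htdef
      set Z : Finset (Fin N) := {x | nl x = t} with hZ
      have hZm : ∀ x, x ∈ Z ↔ nl x = t := fun x => by simp [hZ]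
      have htZ : t ∈ Z := (hZm t).2 htt
      have hZR : ∀ x ∈ Z, x ∈ R := fun x hx => hmemR ((hZm x).1 hx) ht
      have hparZ : ∀ y ∈ Z.erase t, par y ∈ Z := fun y hy => by
        rw [mem_erase] at hy
        exact (hZm _).2 ((hchild ht hpt y (hZR y hy.2)).2 ⟨(hZm y).1 hy.2, hy.1⟩)
      -- Within its branch a vertex is adjacent to its children and, unless it is the top, to its
      -- parent. The ranks show that the parent is not one of the children. Summation counts each of
      -- the `#Z - 1` pointers twice.
      have hlow : ∀ x ∈ Z, (if x = t then 0 else 1) + #{y ∈ Z.erase t | par y = x} ≤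
          #(labelNbs G nl [] x) := by
        intro x hx
        have hsub : {y ∈ Z.erase t | par y = x} ⊆ labelNbs G nl [] x := fun y hy => by
          simp only [mem_filter, mem_erase] at hy
          refine mem_labelNbs.2 ⟨List.not_mem_nil, ?_, ?_⟩
          · rw [← hy.2]; exact (hP.par_adj y (hZR y hy.1.2)).symm
          · rw [(hZm x).1 hx, (hZm y).1 hy.1.2]
        split_ifs with hxt
        · simpa using card_le_card hsub
        · rw [add_comm, ← card_insert_of_notMem (a := par x)]
          · refine card_le_card (insert_subset ?_ hsub)
            refine mem_labelNbs.2 ⟨List.not_mem_nil, hP.par_adj x (hZR x hx), ?_⟩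
            rw [(hZm x).1 hx, ← hZm]
            exact hparZ x (mem_erase.2 ⟨hxt, hx⟩)
          · simp only [mem_filter, mem_erase, not_and]
            rintro ⟨-, hpx⟩ heq
            have h1 := hρ x (hZR x hx)
            have h2 := hρ _ (hZR _ hpx)
            rw [heq] at h2
            omega
      have h1 := Finset.sum_le_sum hlow
      rw [Finset.sum_add_distrib, ← card_eq_sum_card_fiberwise (f := par) hparZ,
        card_erase_of_mem htZ] at h1
      have h3 : ∑ x ∈ Z, (if x = t then 0 else 1) = #Z - 1 := by
        rw [← card_erase_of_mem htZ, card_eq_sum_ones, ← add_sum_erase _ _ htZ, if_pos rfl, zero_add]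
        exact Finset.sum_congr rfl fun x hx => if_neg (mem_erase.1 hx).1
      have := card_pos.2 ⟨t, htZ⟩
      omega
    · simp [hsing u hu]
  · intro u v hl hne
    obtain ⟨c, p, hc, hcl, hp, hps, hpx⟩ := hpath u
    obtain ⟨c', q, hc', hcl', hq, hqs, hqx⟩ := hpath v
    obtain rfl : c = c' := hP.alive_unique hG.isAcyclic hstuck hc hc' (by rw [hcl, hcl', hl])
    -- The ways up from two different branches meet only in the survivor, so their concatenation is
    -- the path from `u` to `v`.
    rw [weightedDist_eq_of_isPath hG w (p.append q.reverse) ?_]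
    · simp [hps, hqs, SimpleGraph.Walk.edges_append, List.sum_reverse]
    · rw [SimpleGraph.Walk.isPath_def, SimpleGraph.Walk.support_append]
      have hqr := hq.reverse.support_nodup
      rw [← SimpleGraph.Walk.cons_tail_support, List.nodup_cons] at hqr
      refine List.nodup_append'.2 ⟨hp.support_nodup, hqr.2, fun x hx hx' => ?_⟩
      have hxq : x ∈ q.support := by
        have := List.mem_of_mem_tail hx'
        simpa using this
      rcases (hpx x hx).2 with rfl | ⟨-, e⟩
      · exact hqr.1 hx'
      · rcases (hqx x hxq).2 with rfl | ⟨-, e'⟩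
        · exact hqr.1 hx'
        · exact hne (e.symm.trans e')

end Peeling

/-! ### Integrals over classes and the edge list -/

section Telescoping

open Finset

variable {N : ℕ} {G : SimpleGraph (Fin N)} {w : Sym2 (Fin N) → ℝ}

/-- Integration restricted to the label classes. -/
noncomputable def classIntegral (G : SimpleGraph (Fin N)) (w : Sym2 (Fin N) → ℝ) (f : ℝ → ℝ)
    (X : Fin N → ℝ) (lab : Fin N → Fin N) (u : Fin N) : ℝ :=
  ∑ v with lab v = lab u, f (weightedDist G w u v) * X v

/-- Integration restricted to the label classes, along paths through a hub at distance `h u` from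
`u`. -/
noncomputable def hubIntegral (f : ℝ → ℝ) (h X : Fin N → ℝ) (lab : Fin N → Fin N) (u : Fin N) : ℝ :=
  ∑ v with lab v = lab u, f (h u + h v) * X v

/-- On the pairs separated by `nl` the two kinds of integrands agree, so passing from `lab` to `nl`
changes both integrals by the same amount. -/
theorem IsHalving.classIntegral_eq {lab nl : Fin N → Fin N} {h : Fin N → ℝ}
    (hh : IsHalving G w lab nl h) (f : ℝ → ℝ) (X : Fin N → ℝ) (u : Fin N) :
    classIntegral G w f X lab u =
      classIntegral G w f X nl u + (hubIntegral f h X lab u - hubIntegral f h X nl u) := by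
  have hsub : univ.filter (fun v => nl v = nl u) ⊆ univ.filter fun v => lab v = lab u := fun v hv => by
    simp only [mem_filter, mem_univ, true_and] at hv ⊢
    exact hh.lab_eq v u hv
  unfold classIntegral hubIntegral
  rw [← Finset.sum_sdiff hsub, ← Finset.sum_sdiff hsub (f := fun v => f (h u + h v) * X v)]
  rw [Finset.sum_congr rfl (s₁ := univ.filter (fun v => lab v = lab u) \
    univ.filter fun v => nl v = nl u) fun v hv => ?_]
  · ring
  · simp only [Finset.mem_sdiff, mem_filter, mem_univ, true_and] at hv
    rw [hh.dist_eq u v hv.1.symm (Ne.symm hv.2)]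

theorem classIntegral_of_card_le_one (hG : G.IsTree) {lab : Fin N → Fin N} (f : ℝ → ℝ)
    (X : Fin N → ℝ) (u : Fin N) (hcard : #{v | lab v = lab u} ≤ 1) :
    classIntegral G w f X lab u = f 0 * X u := by
  have : ({v | lab v = lab u} : Finset (Fin N)) = {u} :=
    (Finset.eq_of_subset_of_card_le (by simp) (by simpa using hcard)).symm
  rw [classIntegral, this, sum_singleton, weightedDist_eq_of_isPath hG w .nil .nil]
  simp

theorem classIntegral_const (f : ℝ → ℝ) (X : Fin N → ℝ) (c : Fin N) (u : Fin N) :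
    classIntegral G w f X (fun _ => c) u = (fDistanceMatrix G w f *ᵥ X) u := by
  simp [classIntegral, fDistanceMatrix, Matrix.mulVec, dotProduct]

theorem SimpleGraph.IsTree.spansTrees_const (hG : G.IsTree) (c : Fin N) :
    SpansTrees G fun _ => c := by
  classical
  intro u
  have h1 := hG.card_edgeFinset
  have h2 := G.sum_degrees_eq_twice_card_edges
  have h3 : ∀ x, #(labelNbs G (fun _ => c) [] x) = G.degree x := fun x => by
    rw [← SimpleGraph.card_neighborFinset_eq_degree]
    congr 1
    ext y
    simp [mem_labelNbs]
  simp only [h3, filter_true]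
  rw [Fintype.card_fin] at h1
  simp only [card_univ, Fintype.card_fin]
  omega

/-- The edge list of a tree enumerates the neighbours of every vertex. -/
theorem sum_edge_list_eq {M : Type*} [AddCommMonoid M] (hG : G.IsTree)
    {src dst : Fin (N - 1) → Fin N} (hrange : Set.range (fun k => s(src k, dst k)) = G.edgeSet)
    (lab : Fin N → Fin N) (u : Fin N) (F : Fin N → M) :
    ∑ k, (if lab (src k) = lab (dst k) then
      (if src k = u then F (dst k) else 0) + (if dst k = u then F (src k) else 0) else 0) =
      ∑ x ∈ labelNbs G lab [] u, F x := by
  classical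
  have hadj : ∀ k, G.Adj (src k) (dst k) := fun k => by
    rw [← SimpleGraph.mem_edgeSet, ← hrange]; exact ⟨k, rfl⟩
  -- A list of `N - 1` entries that covers the `N - 1` edges of a tree has no repetitions.
  have hinj : Function.Injective fun k => s(src k, dst k) := by
    rw [← Set.injOn_univ, ← Finset.coe_univ]
    refine Finset.injOn_of_card_image_eq ?_
    have h1 := hG.card_edgeFinset
    have h2 : univ.image (fun k => s(src k, dst k)) = G.edgeFinset := by
      apply Finset.coe_injective
      simp [← hrange]
    rw [h2]
    rw [Fintype.card_fin] at h1
    rw [card_univ, Fintype.card_fin]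
    omega
  rw [← Finset.sum_filter_add_sum_filter_not _
    (fun k => lab (src k) = lab (dst k) ∧ (src k = u ∨ dst k = u))]
  rw [Finset.sum_eq_zero (s := {k | ¬ _}), add_zero]
  · refine Finset.sum_bij (fun k _ => if src k = u then dst k else src k) ?_ ?_ ?_ ?_
    · intro k hk
      simp only [mem_filter, mem_univ, true_and] at hk
      rw [mem_labelNbs]
      rcases eq_or_ne (src k) u with rfl | hs
      · simpa [hk.1] using hadj k
      · obtain rfl : dst k = u := by simpa [hs] using hk.2
        simpa [hs, hk.1] using (hadj k).symm
    · intro k hk k' hk' heq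
      simp only [mem_filter, mem_univ, true_and] at hk hk'
      have key : ∀ k, (src k = u ∨ dst k = u) →
          s(src k, dst k) = s(u, if src k = u then dst k else src k) := fun k hk => by
        rcases eq_or_ne (src k) u with rfl | hs
        · simp
        · obtain rfl : dst k = u := by simpa [hs] using hk
          simp [hs, Sym2.eq_swap]
      apply hinj
      simp only [key k hk.2, key k' hk'.2, heq]
    · intro x hx
      obtain ⟨-, hux, hl⟩ := mem_labelNbs.1 hx
      have : s(u, x) ∈ Set.range (fun k => s(src k, dst k)) := by
        rw [hrange]; exact hux
      obtain ⟨k, hk⟩ := this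
      rcases Sym2.eq_iff.1 hk with ⟨h1, h2⟩ | ⟨h1, h2⟩
      · exact ⟨k, by simp [h1, h2, hl], by simp [h1, h2]⟩
      · exact ⟨k, by simp [h1, h2, hl], by simp [h1, hux.ne']⟩
    · intro k hk
      simp only [mem_filter, mem_univ, true_and] at hk
      rw [if_pos hk.1]
      rcases eq_or_ne (src k) u with rfl | hs
      · simp [(hadj k).ne']
      · obtain rfl : dst k = u := by simpa [hs] using hk.2
        simp [hs]
  · intro k hk
    simp only [mem_filter, mem_univ, true_and, not_and, not_or] at hk
    split_ifs <;> simp_all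

end Telescoping

/-! ### Memory layout of the tree program -/

notation "rSize" => 0
notation "rIdx" => 5
notation "rCur" => 6
notation "rCnt" => 7
notation "rPar" => 8

notation "aSrc" => 0
notation "aDst" => 1
notation "aLab" => 2
notation "aClassSize" => 3
notation "aDeg" => 4
notation "aNbSum" => 5
notation "aAcc" => 6
notation "aOrd" => 7
notation "aPar" => 8
notation "aNewLab" => 9

notation "aEdgeW" => 0
notation "aNbW" => 3
notation "aParW" => 4
notation "aHub" => 5

/-! ### Initialization, class sizes and degrees -/

namespace RealRAM

variable {ι : Type*} {prim : ι → ℝ → ℝ}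

/-- An increment becomes an additional summand in every cell, which suits loop invariants that are
partial sums. -/
theorem update_add_apply {M : Type*} [AddMonoid M] (a : ℕ → M) (i : ℕ) (x : M) (v : ℕ) :
    Function.update a i (a i + x) v = a v + if i = v then x else 0 := by
  rcases eq_or_ne i v with rfl | h
  · simp
  · simp [h, Ne.symm h]

theorem update_val_apply {N : ℕ} {α : Type*} {a : ℕ → α} {f : Fin N → α}
    (h : ∀ u : Fin N, a u = f u) (v : Fin N) (x : α) (u : Fin N) :
    Function.update a v x u = Function.update f v x u := by
  simp [Function.update_apply, h, Fin.val_inj]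

/-- `arr[i] += e` for a natural-number array. -/
def Prog.incNat (a : ℕ) (i e : NExp) : Prog ι := .setNat a i (.add (.load a i) e)

/-- `arr[i] += e` for a real array. -/
def Prog.incReal (a : ℕ) (i : NExp) (e : RExp ι) : Prog ι := .setReal a i (.add (.load a i) e)

/-- Initialize the arrays of one round. -/
def initBody : Prog ι :=
  .setNat aClassSize (.reg rIdx) (.const 0) ;; .setNat aDeg (.reg rIdx) (.const 0) ;;
  .setNat aNbSum (.reg rIdx) (.const 0) ;; .setNat aAcc (.reg rIdx) (.const 1) ;;
  .setNat aPar (.reg rIdx) (.reg rIdx) ;; .setNat aNewLab (.reg rIdx) (.reg rIdx) ;;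
  .setReal aNbW (.reg rIdx) (.const 0) ;; .setReal aHub (.reg rIdx) (.const 0)

def initArrays : Prog ι := .for rIdx (.reg rSize) initBody

def countBody : Prog ι := .incNat aClassSize (.load aLab (.reg rIdx)) (.const 1)

/-- Compute the class sizes. -/
def countClasses : Prog ι := .for rIdx (.reg rSize) countBody

def edgeBody : Prog ι :=
  .ite (.neq (.load aLab (.load aSrc (.reg rIdx))) (.load aLab (.load aDst (.reg rIdx))))
    (.incNat aDeg (.load aSrc (.reg rIdx)) (.const 1) ;;
     .incNat aDeg (.load aDst (.reg rIdx)) (.const 1) ;;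
     .incNat aNbSum (.load aSrc (.reg rIdx)) (.load aDst (.reg rIdx)) ;;
     .incNat aNbSum (.load aDst (.reg rIdx)) (.load aSrc (.reg rIdx)) ;;
     .incReal aNbW (.load aSrc (.reg rIdx)) (.load aEdgeW (.reg rIdx)) ;;
     .incReal aNbW (.load aDst (.reg rIdx)) (.load aEdgeW (.reg rIdx)))
    .skip

/-- Compute degrees, neighbour sums and neighbour weights from the edge list. -/
def scanEdges : Prog ι := .for rIdx (.sub (.reg rSize) (.const 1)) edgeBody

theorem exec_initArrays {N : ℕ} {s : State} (hN : s.reg rSize = N) :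
    Exec prim (initArrays : Prog ι) s (40 * N + 6) fun s' => ∀ u < N,
      s'.nat aClassSize u = 0 ∧ s'.nat aDeg u = 0 ∧ s'.nat aNbSum u = 0 ∧ s'.nat aAcc u = 1 ∧
      s'.nat aPar u = u ∧ s'.nat aNewLab u = u ∧ s'.real aNbW u = 0 ∧ s'.real aHub u = 0 := by
  refine (Exec.for (n := N) (B := fun _ => 32) (fun k s' => ∀ u < k,
      s'.nat aClassSize u = 0 ∧ s'.nat aDeg u = 0 ∧ s'.nat aNbSum u = 0 ∧ s'.nat aAcc u = 1 ∧
      s'.nat aPar u = u ∧ s'.nat aNewLab u = u ∧ s'.real aNbW u = 0 ∧ s'.real aHub u = 0)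
      ?_ ?_ ?_ ?_ ?_).mono ?_ fun _ h => h
  · intro s' hf
    simp [NExp.eval, hf.reg rSize (by simp [Prog.WritesReg, initBody]), hN]
  · simp [Prog.WritesReg, initBody]
  · intro k s m h
    simpa using h
  · simp
  · intro k hk s' hf hi hI
    refine (Exec.of_loopFree (by simp [Prog.LoopFree, initBody]) ?_).mono
      (by simp [initBody, Prog.maxCost, NExp.cost, RExp.cost]) fun _ h => h
    intro u hu
    simp only [initBody, Prog.run, NExp.eval, RExp.eval, State.writeReal_nat,
      State.writeNat_nat, State.writeReal_real, State.writeNat_real, State.writeNat_reg,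
      State.writeReal_reg, hi]
    rcases Nat.lt_succ_iff_lt_or_eq.1 hu with h | rfl
    · simpa [h.ne] using hI u h
    · simp
  · simp [NExp.cost]
    omega

theorem exec_countClasses {N : ℕ} {s : State} (hN : s.reg rSize = N) {lab : Fin N → Fin N}
    (hlab : ∀ u : Fin N, s.nat aLab u = lab u) (hzero : ∀ u < N, s.nat aClassSize u = 0) :
    Exec prim (countClasses : Prog ι) s (20 * N + 6) fun s' =>
      ∀ l : Fin N, s'.nat aClassSize l = Finset.card {u | lab u = l} := by
  refine (Exec.for (n := N) (B := fun _ => 10) (fun k s' => ∀ l : Fin N,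
      s'.nat aClassSize l = ∑ j ∈ Finset.range k, if s.nat aLab j = l then 1 else 0)
      ?_ ?_ ?_ ?_ ?_).mono ?_ fun s' h => ?_
  · intro s' hf
    simp [NExp.eval, hf.reg rSize (by simp [Prog.WritesReg, countBody, Prog.incNat]), hN]
  · simp [Prog.WritesReg, countBody, Prog.incNat]
  · intro k s m h
    simpa using h
  · simpa using fun l : Fin N => hzero l l.2
  · intro k hk s' hf hi hI
    refine (Exec.of_loopFree (by simp [Prog.LoopFree, countBody, Prog.incNat]) ?_).mono
      (by simp [countBody, Prog.incNat, Prog.maxCost, NExp.cost]) fun _ h => h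
    intro l
    have h1 := hf.nat aLab (by simp [Prog.WritesNat, countBody, Prog.incNat])
    simp only [countBody, Prog.incNat, Prog.run, NExp.eval, State.writeNat_nat, hi, if_true, h1]
    rw [update_add_apply, Finset.sum_range_succ, hI]
  · simp [NExp.cost]
    omega
  · intro l
    rw [h l, Finset.sum_range, Finset.card_filter]
    exact Finset.sum_congr rfl fun u _ => by simp [hlab, Fin.val_inj]

/-- The sums run over positions in the raw edge list, without reference to a graph;
`sum_edge_list_eq` turns them into sums over neighbours. -/
theorem exec_scanEdges {N : ℕ} {s : State} (hN : s.reg rSize = N)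
    (hzero : ∀ u < N, s.nat aDeg u = 0 ∧ s.nat aNbSum u = 0 ∧ s.real aNbW u = 0) :
    Exec prim (scanEdges : Prog ι) s (80 * N + 10) fun s' => ∀ u < N,
      s'.nat aDeg u = ∑ j ∈ Finset.range (N - 1),
        (if s.nat aLab (s.nat aSrc j) = s.nat aLab (s.nat aDst j) then
          (if s.nat aSrc j = u then 1 else 0) + (if s.nat aDst j = u then 1 else 0) else 0) ∧
      s'.nat aNbSum u = ∑ j ∈ Finset.range (N - 1),
        (if s.nat aLab (s.nat aSrc j) = s.nat aLab (s.nat aDst j) then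
          (if s.nat aSrc j = u then s.nat aDst j else 0) +
            (if s.nat aDst j = u then s.nat aSrc j else 0) else 0) ∧
      s'.real aNbW u = ∑ j ∈ Finset.range (N - 1),
        (if s.nat aLab (s.nat aSrc j) = s.nat aLab (s.nat aDst j) then
          (if s.nat aSrc j = u then s.real aEdgeW j else 0) +
            (if s.nat aDst j = u then s.real aEdgeW j else 0) else 0) := by
  refine (Exec.for (n := N - 1) (B := fun _ => 70) (fun k s' => ∀ u < N,
      s'.nat aDeg u = ∑ j ∈ Finset.range k,
        (if s.nat aLab (s.nat aSrc j) = s.nat aLab (s.nat aDst j) then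
          (if s.nat aSrc j = u then 1 else 0) + (if s.nat aDst j = u then 1 else 0) else 0) ∧
      s'.nat aNbSum u = ∑ j ∈ Finset.range k,
        (if s.nat aLab (s.nat aSrc j) = s.nat aLab (s.nat aDst j) then
          (if s.nat aSrc j = u then s.nat aDst j else 0) +
            (if s.nat aDst j = u then s.nat aSrc j else 0) else 0) ∧
      s'.real aNbW u = ∑ j ∈ Finset.range k,
        (if s.nat aLab (s.nat aSrc j) = s.nat aLab (s.nat aDst j) then
          (if s.nat aSrc j = u then s.real aEdgeW j else 0) +
            (if s.nat aDst j = u then s.real aEdgeW j else 0) else 0))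
      ?_ ?_ ?_ ?_ ?_).mono ?_ fun _ h => h
  · intro s' hf
    simp [NExp.eval, hN,
      hf.reg rSize (by simp [Prog.WritesReg, edgeBody, Prog.incNat, Prog.incReal])]
  · simp [Prog.WritesReg, edgeBody, Prog.incNat, Prog.incReal]
  · intro k s m h
    simpa using h
  · simpa using hzero
  · intro k hk s' hf hi hI
    refine (Exec.of_loopFree (by simp [Prog.LoopFree, edgeBody, Prog.incNat, Prog.incReal])
      ?_).mono (by simp [edgeBody, Prog.incNat, Prog.incReal, Prog.maxCost, NExp.cost, RExp.cost,
        Test.cost]) fun _ h => h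
    have h1 := hf.nat aLab (by simp [Prog.WritesNat, edgeBody, Prog.incNat, Prog.incReal])
    have h2 := hf.nat aSrc (by simp [Prog.WritesNat, edgeBody, Prog.incNat, Prog.incReal])
    have h3 := hf.nat aDst (by simp [Prog.WritesNat, edgeBody, Prog.incNat, Prog.incReal])
    have h4 := hf.real aEdgeW (by simp [Prog.WritesReal, edgeBody, Prog.incNat, Prog.incReal])
    intro u hu
    obtain ⟨i1, i2, i3⟩ := hI u hu
    simp only [edgeBody, Prog.run, Test.Holds, NExp.eval, hi, h1, h2, h3, Finset.sum_range_succ,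
      ← i1, ← i2, ← i3]
    by_cases hl : s.nat aLab (s.nat aSrc k) = s.nat aLab (s.nat aDst k)
    · simp only [if_pos hl, Prog.incNat, Prog.incReal, Prog.run, NExp.eval, RExp.eval, hi, h2, h3,
        h4, State.writeNat_nat, State.writeNat_reg, State.writeNat_real, State.writeReal_real,
        State.writeReal_nat, State.writeReal_reg, Nat.reduceEqDiff, if_true, if_false,
        OfNat.zero_ne_ofNat, OfNat.one_ne_ofNat]
      refine ⟨?_, ?_, ?_⟩ <;> rw [update_add_apply, update_add_apply, add_assoc]
    · simp [hl]
  · simp [NExp.cost]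
    omega

end RealRAM

/-! ### The peeling program and the new labels -/

namespace RealRAM

variable {ι : Type*} {prim : ι → ℝ → ℝ} {N : ℕ}

/-- The array `a` holds a list, its last element first. -/
def StoresStack (a : ℕ → ℕ) : List (Fin N) → Prop
  | [] => True
  | v :: R => a R.length = v ∧ StoresStack a R

theorem StoresStack.update {a : ℕ → ℕ} {R : List (Fin N)} (h : StoresStack a R) {i : ℕ}
    (hi : R.length ≤ i) (x : ℕ) : StoresStack (Function.update a i x) R := by
  induction R with
  | nil => trivial
  | cons v R ih =>
    rw [List.length_cons] at hi
    exact ⟨by rw [Function.update_of_ne (by omega)]; exact h.1, ih h.2 (by omega)⟩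

/-- The memory holds the data of a peeling. -/
structure StoresPeeling (s : State) (lab : Fin N → Fin N) (R : List (Fin N))
    (deg ns acc : Fin N → ℕ) (ws pw : Fin N → ℝ) (par : Fin N → Fin N) : Prop where
  size : s.reg rSize = N
  cnt : s.reg rCnt = R.length
  ord : StoresStack (s.nat aOrd) R
  lab_eq : ∀ u : Fin N, s.nat aLab u = lab u
  class_eq : ∀ l : Fin N, s.nat aClassSize l = Finset.card {u | lab u = l}
  deg_eq : ∀ u : Fin N, s.nat aDeg u = deg u
  ns_eq : ∀ u : Fin N, s.nat aNbSum u = ns u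
  acc_eq : ∀ u : Fin N, s.nat aAcc u = acc u
  par_eq : ∀ u : Fin N, s.nat aPar u = par u
  ws_eq : ∀ u : Fin N, s.real aNbW u = ws u
  pw_eq : ∀ u : Fin N, s.real aParW u = pw u

/-- The vertex in register `rCur` is a leaf that can be removed. -/
def canPeel : Test ι :=
  .and (.neq (.load aDeg (.reg rCur)) (.const 1))
    (.not (.nlt (.load aClassSize (.load aLab (.reg rCur)))
      (.add (.load aAcc (.reg rCur)) (.load aAcc (.reg rCur)))))

/-- Remove the leaf in register `rCur` and continue with its neighbour. -/
def peelLeaf : Prog ι :=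
  .setReg rPar (.load aNbSum (.reg rCur)) ;;
  .setNat aPar (.reg rCur) (.reg rPar) ;;
  .setReal aParW (.reg rCur) (.load aNbW (.reg rCur)) ;;
  .setReal aNbW (.reg rPar) (.sub (.load aNbW (.reg rPar)) (.load aNbW (.reg rCur))) ;;
  .setNat aAcc (.reg rPar) (.add (.load aAcc (.reg rPar)) (.load aAcc (.reg rCur))) ;;
  .setNat aDeg (.reg rCur) (.const 0) ;;
  .setNat aDeg (.reg rPar) (.sub (.load aDeg (.reg rPar)) (.const 1)) ;;
  .setNat aNbSum (.reg rPar) (.sub (.load aNbSum (.reg rPar)) (.reg rCur)) ;;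
  .setNat aOrd (.reg rCnt) (.reg rCur) ;;
  .setReg rCnt (.add (.reg rCnt) (.const 1)) ;;
  .setReg rCur (.reg rPar)

def nextVertex : Prog ι :=
  .setReg rIdx (.add (.reg rIdx) (.const 1)) ;; .setReg rCur (.reg rIdx)

/-- Remove leaves from the classes until only one vertex of each class is left. -/
def peel : Prog ι :=
  (.setReg rCnt (.const 0) ;; .setReg rIdx (.const 0) ;; .setReg rCur (.const 0)) ;;
  .while (.nlt (.reg rIdx) (.reg rSize)) (.ite canPeel peelLeaf nextVertex)

theorem StoresPeeling.step {s : State} {w : Sym2 (Fin N) → ℝ} {lab : Fin N → Fin N} {R : List (Fin N)}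
    {deg ns acc : Fin N → ℕ} {ws pw : Fin N → ℝ} {par : Fin N → Fin N}
    (hs : StoresPeeling s lab R deg ns acc ws pw par)
    {v p : Fin N} (hcur : s.reg rCur = v) (hns : ns v = p) (hpv : p ≠ v)
    (hws : ws v = w s(v, p)) :
    StoresPeeling (peelLeaf.run prim s) lab (v :: R)
      (Function.update (Function.update deg v 0) p (deg p - 1))
      (Function.update ns p (ns p - v)) (Function.update acc p (acc p + acc v))
      (Function.update ws p (ws p - w s(v, p))) (Function.update pw v (w s(v, p)))
      (Function.update par v p) ∧ (peelLeaf.run prim s).reg rCur = p ∧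
      (peelLeaf.run prim s).reg rIdx = s.reg rIdx := by
  have hvp : ¬ (p : ℕ) = v := fun e => hpv (Fin.ext e)
  have hp : s.nat aNbSum v = p := (hs.ns_eq v).trans hns
  have hcnt := hs.cnt
  refine ⟨⟨?_, ?_, ?_, ?_, ?_, ?_, ?_, ?_, ?_, ?_, ?_⟩, ?_, ?_⟩
  · simpa [peelLeaf, Prog.run] using hs.size
  · simp [peelLeaf, Prog.run, NExp.eval, hs.cnt]
  · refine ⟨?_, ?_⟩
    · simp [peelLeaf, Prog.run, NExp.eval, hs.cnt, hcur]
    · simpa [peelLeaf, Prog.run, NExp.eval] using hs.ord.update hs.cnt.ge _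
  · simpa [peelLeaf, Prog.run] using hs.lab_eq
  · simpa [peelLeaf, Prog.run] using hs.class_eq
  · intro u
    have := update_val_apply (update_val_apply hs.deg_eq v 0) p (deg p - 1) u
    simpa [peelLeaf, Prog.run, NExp.eval, hcur, hp, hvp, hs.deg_eq] using this
  · intro u
    have := update_val_apply hs.ns_eq p (ns p - v) u
    simpa [peelLeaf, Prog.run, NExp.eval, hcur, hp, hvp, hs.ns_eq, hns] using this
  · intro u
    have := update_val_apply hs.acc_eq p (acc p + acc v) u
    simpa [peelLeaf, Prog.run, NExp.eval, hcur, hp, hvp, hs.acc_eq] using this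
  · intro u
    have := update_val_apply (f := fun u => (par u : ℕ)) hs.par_eq v (p : ℕ) u
    simp only [peelLeaf, Prog.run, NExp.eval, hcur, hp, State.writeReg_nat, State.writeNat_nat,
      State.writeReal_nat, State.writeReg_reg, State.writeNat_reg, State.writeReal_reg]
    simp [this, Function.update_apply]
    split_ifs <;> rfl
  · intro u
    have := update_val_apply hs.ws_eq p (ws p - w s(v, p)) u
    simpa [peelLeaf, Prog.run, NExp.eval, RExp.eval, hcur, hp, hvp, hs.ws_eq, hws] using this
  · intro u
    have := update_val_apply hs.pw_eq v (w s(v, p)) u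
    simpa [peelLeaf, Prog.run, NExp.eval, RExp.eval, hcur, hp, hvp, hs.ws_eq, hws] using this
  · simp [peelLeaf, Prog.run, NExp.eval, hcur, hp]
  · simp [peelLeaf, Prog.run]

theorem StoresPeeling.congr {s s' : State} {lab : Fin N → Fin N} {R : List (Fin N)}
    {deg ns acc : Fin N → ℕ} {ws pw : Fin N → ℝ} {par : Fin N → Fin N}
    (hs : StoresPeeling s lab R deg ns acc ws pw par) (hsize : s'.reg rSize = s.reg rSize)
    (hcnt : s'.reg rCnt = s.reg rCnt) (hnat : s'.nat = s.nat) (hreal : s'.real = s.real) :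
    StoresPeeling s' lab R deg ns acc ws pw par := by
  obtain ⟨h1, h2, h3, h4, h5, h6, h7, h8, h9, h10, h11⟩ := hs
  constructor <;> simp_all

theorem holds_canPeel {s : State} {lab : Fin N → Fin N} {R : List (Fin N)}
    {deg ns acc : Fin N → ℕ} {ws pw : Fin N → ℝ} {par : Fin N → Fin N}
    (hs : StoresPeeling s lab R deg ns acc ws pw par) {v : Fin N} (hcur : s.reg rCur = v) :
    (canPeel : Test ι).Holds prim s ↔
      deg v = 1 ∧ 2 * acc v ≤ Finset.card {u | lab u = lab v} := by
  simp [canPeel, Test.Holds, NExp.eval, hcur, hs.deg_eq, hs.lab_eq, hs.class_eq, hs.acc_eq,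
    two_mul]

/-- The memory is described after clearing `rCnt` because the program itself does so first; the
previous contents of this register are arbitrary. -/
theorem exec_peel {s : State} {G : SimpleGraph (Fin N)} {w : Sym2 (Fin N) → ℝ}
    {lab : Fin N → Fin N} {deg ns acc : Fin N → ℕ} {ws pw : Fin N → ℝ} {par : Fin N → Fin N}
    (hP : Peeling G w lab [] deg ns acc ws pw par)
    (hs : StoresPeeling (s.writeReg rCnt 0) lab [] deg ns acc ws pw par) :
    Exec prim (peel : Prog ι) s (200 * N + 20) fun s' => ∃ R deg ns acc ws pw par,
      Peeling G w lab R deg ns acc ws pw par ∧ StoresPeeling s' lab R deg ns acc ws pw par ∧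
      ∀ u, deg u = 1 → Finset.card {x | lab x = lab u} < 2 * acc u := by
  -- Among the vertices scanned so far, only the current one may be a removable leaf: a removal
  -- alters only the neighbour's claim to be one, and the neighbour becomes current. When the scan
  -- is over, `rCur` is `N`, which exempts no vertex.
  let I : State → Prop := fun s' => (∃ R deg ns acc ws pw par,
      Peeling G w lab R deg ns acc ws pw par ∧ StoresPeeling s' lab R deg ns acc ws pw par ∧
      ∀ u : Fin N, (u : ℕ) ≤ s'.reg rIdx → (u : ℕ) ≠ s'.reg rCur → deg u = 1 →
        Finset.card {x | lab x = lab u} < 2 * acc u) ∧ s'.reg rIdx ≤ N ∧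
      (s'.reg rIdx < N → s'.reg rCur < N) ∧ (s'.reg rIdx = N → s'.reg rCur = N)
  refine Exec.mono (Exec.seq_of (t := 6) (t' := 2 * N * 90 + 4) (R := I) ?_ ?_) (by omega)
    fun _ h => h
  · refine (Exec.of_loopFree (by simp [Prog.LoopFree]) ?_).mono
      (by simp [Prog.maxCost, NExp.cost]) fun _ h => h
    refine ⟨⟨[], deg, ns, acc, ws, pw, par, hP, hs.congr ?_ ?_ ?_ ?_, ?_⟩, ?_, ?_, ?_⟩
    · simp [Prog.run]
    · simp [Prog.run, NExp.eval]
    · simp [Prog.run]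
    · simp [Prog.run]
    · intro u hu hu'
      simp [Prog.run, NExp.eval] at hu hu'
      exact absurd hu hu'
    all_goals simp [Prog.run, NExp.eval]
  · intro s₁ h₁
    refine (Exec.while_variant (B := 86) I
      -- Each round either advances the scan or removes a vertex, so there are at most `2 * N`
      -- rounds although the walk may return to scanned vertices.
      (fun s' => (N - s'.reg rIdx) + (N - s'.reg rCnt)) h₁ ?_).mono ?_ ?_
    · rintro s' ⟨⟨R, deg, ns, acc, ws, pw, par, hP, hs, hstuck⟩, hle, hlt, hend⟩ hb
      have hi : s'.reg rIdx < N := by simpa [Test.Holds, NExp.eval, hs.size] using hb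
      obtain ⟨v, hv⟩ : ∃ v : Fin N, s'.reg rCur = v := ⟨⟨_, hlt hi⟩, rfl⟩
      refine (Exec.of_loopFree (by simp [Prog.LoopFree, peelLeaf, nextVertex]) ?_).mono
        (by simp [Prog.maxCost, NExp.cost, RExp.cost, Test.cost, peelLeaf, nextVertex, canPeel])
        fun _ h => h
      rw [Prog.run]
      split_ifs with hc
      · rw [holds_canPeel hs hv] at hc
        obtain ⟨hvR, p, hpR, hpv, hadj, hlab, hnb, hns, hws⟩ := hP.exists_parent hc.1
        have hP' := hP.step hc.1 hc.2 hvR hpR hpv hadj hlab hnb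
        obtain ⟨hs', hcur', hidx'⟩ := hs.step (prim := prim) hv hns hpv hws
        refine ⟨⟨⟨_, _, _, _, _, _, _, hP', hs', ?_⟩, ?_, ?_, ?_⟩, ?_⟩
        · intro u hu hup hd
          rw [hidx'] at hu
          rw [hcur', Ne, Fin.val_inj] at hup
          rw [Function.update_of_ne hup] at hd ⊢
          rcases eq_or_ne u v with rfl | huv
          · simp at hd
          · rw [Function.update_of_ne huv] at hd
            exact hstuck u hu (by rwa [hv, Ne, Fin.val_inj]) hd
        · rw [hidx']; exact hle
        · intro _; rw [hcur']; exact p.2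
        · intro h; omega
        · have h1 := hs'.cnt
          have h2 := hP'.nodup.length_le_card
          have h3 := hs.cnt
          rw [Fintype.card_fin] at h2
          rw [List.length_cons] at h1 h2
          omega
      · rw [holds_canPeel hs hv] at hc
        refine ⟨⟨⟨R, deg, ns, acc, ws, pw, par, hP, hs.congr ?_ ?_ ?_ ?_, ?_⟩, ?_, ?_, ?_⟩, ?_⟩
        · simp [nextVertex, Prog.run]
        · simp [nextVertex, Prog.run]
        · simp [nextVertex, Prog.run]
        · simp [nextVertex, Prog.run]
        · intro u hu hu' hd
          simp only [nextVertex, Prog.run, NExp.eval, State.writeReg_reg, Nat.reduceEqDiff,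
            if_true, if_false] at hu hu'
          rcases eq_or_ne u v with rfl | huv
          · by_contra hn
            exact hc ⟨hd, not_lt.1 hn⟩
          · exact hstuck u (by omega) (by rwa [hv, Ne, Fin.val_inj]) hd
        · simp [nextVertex, Prog.run, NExp.eval]; omega
        · simp [nextVertex, Prog.run, NExp.eval]
        · simp [nextVertex, Prog.run, NExp.eval]
        · simp [nextVertex, Prog.run, NExp.eval]; omega
    · simp only [Test.cost, NExp.cost]
      have : (N - s₁.reg rIdx) + (N - s₁.reg rCnt) ≤ 2 * N := by omega
      have := Nat.mul_le_mul_right 90 this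
      omega
    · rintro s' ⟨⟨⟨R, deg, ns, acc, ws, pw, par, hP, hs, hstuck⟩, hle, hlt, hend⟩, hb⟩
      have hi : ¬ s'.reg rIdx < N := by simpa [Test.Holds, NExp.eval, hs.size] using hb
      refine ⟨R, deg, ns, acc, ws, pw, par, hP, hs, fun u hd => ?_⟩
      have := hend (by omega)
      exact hstuck u (by omega) (by omega) hd

/-- Compute the distance to the root and the new label of the vertex removed last. -/
def popVertex : Prog ι :=
  .setReg rCnt (.sub (.reg rCnt) (.const 1)) ;;
  .setReg rCur (.load aOrd (.reg rCnt)) ;;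
  .setReg rPar (.load aPar (.reg rCur)) ;;
  .setReal aHub (.reg rCur) (.add (.load aHub (.reg rPar)) (.load aParW (.reg rCur))) ;;
  .ite (.neq (.load aPar (.reg rPar)) (.reg rPar)) .skip
    (.setNat aNewLab (.reg rCur) (.load aNewLab (.reg rPar)))

def relabel : Prog ι := .while (.nlt (.const 0) (.reg rCnt)) popVertex

/-- Vertices are popped in the reverse order of removal. A parent was removed after its child or not
at all, so its values are final when the child needs them. -/
theorem exec_relabel {s : State} {G : SimpleGraph (Fin N)} {w : Sym2 (Fin N) → ℝ}
    {lab : Fin N → Fin N} {R : List (Fin N)} {deg ns acc : Fin N → ℕ} {ws pw : Fin N → ℝ}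
    {par : Fin N → Fin N}
    (hP : Peeling G w lab R deg ns acc ws pw par)
    (hs : StoresPeeling s lab R deg ns acc ws pw par)
    (hinit : ∀ u : Fin N, s.real aHub u = 0 ∧ s.nat aNewLab u = u) :
    Exec prim (relabel : Prog ι) s (50 * N + 10) fun s' => ∃ (h : Fin N → ℝ) (nl : Fin N → Fin N),
      (∀ u : Fin N, s'.real aHub u = h u ∧ s'.nat aNewLab u = nl u) ∧
      (∀ u ∉ R, h u = 0) ∧ (∀ u ∉ R, nl u = u) ∧ (∀ u ∈ R, h u = h (par u) + pw u) ∧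
      ∀ u ∈ R, nl u = if par u ∈ R then nl (par u) else u := by
  -- `D` is the part of `R` already popped and `R'` the part still on the stack.
  let I : State → Prop := fun s' => Frame (relabel : Prog ι) s s' ∧ ∃ (D R' : List (Fin N))
      (h : Fin N → ℝ) (nl : Fin N → Fin N), R = D ++ R' ∧ s'.reg rCnt = R'.length ∧
      (∀ u : Fin N, s'.real aHub u = h u ∧ s'.nat aNewLab u = nl u) ∧
      (∀ u ∉ D, h u = 0) ∧ (∀ u ∉ D, nl u = u) ∧ (∀ u ∈ D, h u = h (par u) + pw u) ∧
      ∀ u ∈ D, nl u = if par u ∈ R then nl (par u) else u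
  have h0 : I s := ⟨.refl _ _, [], R, fun _ => 0, id, rfl, hs.cnt, hinit, by simp⟩
  refine (Exec.while_variant (B := 30) I (fun s' => s'.reg rCnt) h0 ?_).mono ?_ ?_
  · rintro s' ⟨hf, D, R', h, nl, hR, hcnt, hmem, h1, h2, h3, h4⟩ hb
    obtain ⟨v, R'', rfl⟩ : ∃ v R'', R' = v :: R'' := by
      cases R' with
      | nil => simp [Test.Holds, NExp.eval, hcnt] at hb
      | cons v R'' => exact ⟨v, R'', rfl⟩
    have e1 := hf.nat aOrd (by simp [relabel, popVertex, Prog.WritesNat])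
    have e2 := hf.nat aPar (by simp [relabel, popVertex, Prog.WritesNat])
    have e3 := hf.real aParW (by simp [relabel, popVertex, Prog.WritesReal])
    have hord : s.nat aOrd R''.length = v := by
      have : ∀ (D : List (Fin N)), StoresStack (s.nat aOrd) (D ++ v :: R'') →
          s.nat aOrd R''.length = v := by
        intro D
        induction D with
        | nil => exact fun h => h.1
        | cons x D ih => exact fun h => ih h.2
      exact this D (hR ▸ hs.ord)
    have hvR : v ∈ R := by simp [hR]
    have hnodup := hP.nodup
    rw [hR, List.nodup_append] at hnodup
    have hvD : v ∉ D := fun hv => hnodup.2.2 v hv v (by simp) rfl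
    have hpne : par v ≠ v := (hP.par_adj v hvR).ne'
    -- No vertex treated so far has `v` as its parent, so writing the values of `v` keeps their
    -- equations intact.
    have hDpar : ∀ u ∈ D, par u ≠ v := fun u hu => by
      have := hP.order
      rw [hR, List.pairwise_append] at this
      exact this.2.2 u hu v (by simp)
    -- Survivors are recognized by pointing to themselves, so no separate marks are needed.
    have hroot : par (par v) = par v ↔ par v ∉ R :=
       ⟨fun h hR => (hP.par_adj _ hR).ne' h, hP.par_self _⟩
    have hcnt' : s'.reg rCnt = R''.length + 1 := by simpa using hcnt
    refine ((Exec.of_loopFree (c := (popVertex : Prog ι)) (prim := prim) (s := s') (Q := fun s'' =>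
      (∃ (D R' : List (Fin N))
      (h : Fin N → ℝ) (nl : Fin N → Fin N), R = D ++ R' ∧ s''.reg rCnt = R'.length ∧
      (∀ u : Fin N, s''.real aHub u = h u ∧ s''.nat aNewLab u = nl u) ∧
      (∀ u ∉ D, h u = 0) ∧ (∀ u ∉ D, nl u = u) ∧ (∀ u ∈ D, h u = h (par u) + pw u) ∧
      ∀ u ∈ D, nl u = if par u ∈ R then nl (par u) else u) ∧ s''.reg rCnt < s'.reg rCnt)
      (by simp [Prog.LoopFree, popVertex]) ?_).frame).mono
      (by simp [Prog.maxCost, NExp.cost, RExp.cost, Test.cost, popVertex])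
      fun s'' hq => ⟨⟨hf.trans ⟨hq.2.reg, hq.2.nat, hq.2.real⟩, hq.1.1⟩, hq.1.2⟩
    refine ⟨⟨D ++ [v], R'', Function.update h v (h (par v) + pw v),
      Function.update nl v (if par v ∈ R then nl (par v) else v), by simp [hR], ?_, ?_, ?_, ?_, ?_, ?_⟩,
      ?_⟩
    · simp [popVertex, Prog.run, NExp.eval, Test.Holds, hcnt']
    · have hh : ∀ u : Fin N, s'.real aHub u = h u := fun u => (hmem u).1
      have hn : ∀ u : Fin N, s'.nat aNewLab u = nl u := fun u => (hmem u).2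
      intro u
      have u1 := update_val_apply hh v (h (par v) + pw v) u
      have u2 := update_val_apply (f := fun u => (nl u : ℕ)) hn v (nl (par v) : ℕ) u
      refine ⟨?_, ?_⟩
      · rw [← u1]
        simp [popVertex, Prog.run, NExp.eval, RExp.eval, Test.Holds, hcnt', e1, e2, e3, hord, hs.par_eq,
          hs.pw_eq, hh]
      · simp only [popVertex, Prog.run, NExp.eval, Test.Holds, hcnt', e1, e2, hord, hs.par_eq, hn,
          State.writeReg_reg, State.writeReg_nat, State.writeNat_nat, State.writeReal_nat,
          State.writeReal_reg, State.ite_nat, Fin.val_inj, hroot, Nat.add_sub_cancel,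
          Nat.reduceEqDiff, if_true, if_false]
        by_cases hpR : par v ∈ R
        · simp only [hpR, not_true, if_false, if_true, u2]
          simp only [Function.update_apply]
          split_ifs <;> rfl
        · simp only [hpR, not_false_iff, if_true, if_false, hn, Function.update_apply]
          split_ifs with huv
          · rw [huv, h2 v hvD]
          · rfl
    · intro u hu
      simp only [List.mem_append, List.mem_singleton, not_or] at hu
      rw [Function.update_of_ne hu.2, h1 u hu.1]
    · intro u hu
      simp only [List.mem_append, List.mem_singleton, not_or] at hu
      rw [Function.update_of_ne hu.2, h2 u hu.1]
    · intro u hu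
      rcases eq_or_ne u v with rfl | huv
      · rw [Function.update_self, Function.update_of_ne hpne]
      · have hu : u ∈ D := by simpa [huv] using hu
        rw [Function.update_of_ne huv, Function.update_of_ne (hDpar u hu), h3 u hu]
    · intro u hu
      rcases eq_or_ne u v with rfl | huv
      · rw [Function.update_self, Function.update_of_ne hpne]
      · have hu : u ∈ D := by simpa [huv] using hu
        rw [Function.update_of_ne huv, Function.update_of_ne (hDpar u hu), h4 u hu]
    · simp [popVertex, Prog.run, NExp.eval, Test.Holds, hcnt']
  · simp only [Test.cost, NExp.cost]
    have h1 := hs.cnt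
    have h2 := hP.nodup.length_le_card
    rw [Fintype.card_fin] at h2
    omega
  · rintro s' ⟨⟨hf, D, R', h, nl, hR, hcnt, hmem, h1, h2, h3, h4⟩, hb⟩
    have : R' = [] := by
      have : s'.reg rCnt = 0 := by simpa [Test.Holds, NExp.eval] using hb
      exact List.length_eq_zero_iff.1 (hcnt ▸ this)
    subst this
    rw [List.append_nil] at hR
    subst hR
    exact ⟨h, nl, hmem, h1, h2, h3, h4⟩

end RealRAM

notation "rLen" => 9
notation "rLab" => 10

notation "aHead" => 10
notation "aNext" => 11

notation "aField" => 6
notation "aRes" => 7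

namespace RealRAM

variable {ι : Type*} {prim : ι → ℝ → ℝ} {N : ℕ}

/-! ### Linked lists -/

/-- Following the pointers `next` from `start`, one runs through the given list and arrives at `N`. -/
def IsLinked (next : ℕ → ℕ) : ℕ → List (Fin N) → Prop
  | start, [] => start = N
  | start, v :: c => start = v ∧ IsLinked next (next v) c

theorem IsLinked.update {next : ℕ → ℕ} {start : ℕ} {c : List (Fin N)} (h : IsLinked next start c)
    {v : ℕ} (hv : ∀ u ∈ c, (u : ℕ) ≠ v) (x : ℕ) : IsLinked (Function.update next v x) start c := by
  induction c generalizing start with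
  | nil => exact h
  | cons u c ih =>
    refine ⟨h.1, ?_⟩
    rw [Function.update_of_ne (hv u (by simp))]
    exact ih h.2 fun y hy => hv y (by simp [hy])

def clearHeads : Prog ι := .for rIdx (.reg rSize) (.setNat aHead (.reg rIdx) (.reg rSize))

/-- Prepend the vertex `rIdx` to the list of its label, where `a` is the array of labels. -/
def linkBody (a : ℕ) : Prog ι :=
  .setNat aNext (.reg rIdx) (.load aHead (.load a (.reg rIdx))) ;;
  .setNat aHead (.load a (.reg rIdx)) (.reg rIdx)

/-- Build linked lists of all classes. -/
def linkClasses (a : ℕ) : Prog ι := clearHeads ;; .for rIdx (.reg rSize) (linkBody a)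

theorem exec_linkClasses {a : ℕ} (ha : a ≠ aHead) (ha' : a ≠ aNext) {s : State}
    (hN : s.reg rSize = N) {lab : Fin N → Fin N} (hlab : ∀ u : Fin N, s.nat a u = lab u) :
    Exec prim (linkClasses a : Prog ι) s (40 * N + 20) fun s' => ∀ l : Fin N, ∃ c : List (Fin N),
      c.Nodup ∧ (∀ u, u ∈ c ↔ lab u = l) ∧ IsLinked (s'.nat aNext) (s'.nat aHead l) c := by
  refine Exec.mono (Exec.seq_of (t := 12 * N + 6) (t' := 20 * N + 6) (R := fun s' =>
    (∀ l < N, s'.nat aHead l = N) ∧ Frame (clearHeads : Prog ι) s s') (Exec.frame ?_) ?_)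
    (by omega) fun _ h => h
  · refine (Exec.for (n := N) (B := fun _ => 3) (fun k s' => ∀ l < k, s'.nat aHead l = N)
      ?_ ?_ ?_ ?_ ?_).mono ?_ fun _ h => h
    · intro s' hf
      simp [NExp.eval, hf.reg rSize (by simp [Prog.WritesReg]), hN]
    · simp [Prog.WritesReg]
    · intro k s m h
      simpa using h
    · simp
    · intro k hk s' hf hi hI
      refine (Exec.of_loopFree (by simp [Prog.LoopFree]) ?_).mono
        (by simp [Prog.maxCost, NExp.cost]) fun _ h => h
      intro l hl
      have hN' := hf.reg rSize (by simp [Prog.WritesReg])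
      rcases Nat.lt_succ_iff_lt_or_eq.1 hl with h | rfl
      · simpa [Prog.run, NExp.eval, hi, h.ne] using hI l h
      · simp [Prog.run, NExp.eval, hi, hN', hN]
    · simp [NExp.cost]
      omega
  · rintro s₁ ⟨hhead, hf₁⟩
    have ha₁ : s₁.nat a = s.nat a := hf₁.nat a (by simpa [clearHeads, Prog.WritesNat] using ha)
    have hN₁ : s₁.reg rSize = N := by
      rw [hf₁.reg rSize (by simp [clearHeads, Prog.WritesReg]), hN]
    refine (Exec.for (n := N) (B := fun _ => 9) (fun k s' => ∀ l : Fin N, ∃ c : List (Fin N),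
      c.Nodup ∧ (∀ u, u ∈ c ↔ lab u = l ∧ (u : ℕ) < k) ∧
        IsLinked (s'.nat aNext) (s'.nat aHead l) c) ?_ ?_ ?_ ?_ ?_).mono ?_ fun s' h => ?_
    · intro s' hf
      simp [NExp.eval, hf.reg rSize (by simp [Prog.WritesReg, linkBody]), hN₁]
    · simp [Prog.WritesReg, linkBody]
    · intro k s m h
      simpa using h
    · exact fun l => ⟨[], List.nodup_nil, by simp, hhead l l.2⟩
    · intro k hk s' hf hi hI
      refine (Exec.of_loopFree (by simp [Prog.LoopFree, linkBody]) ?_).mono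
        (by simp [linkBody, Prog.maxCost, NExp.cost]) fun _ h => h
      have hak : s'.nat a k = lab ⟨k, hk⟩ := by
        rw [hf.nat a (by simp [Prog.WritesNat, linkBody, ha, ha']), ha₁, ← hlab]
      intro l
      obtain ⟨c, hnd, hmem, hlink⟩ := hI l
      -- Vertex `k` is in no list yet, so overwriting its pointer breaks none of them.
      have hlt : ∀ u ∈ c, (u : ℕ) ≠ k := fun u hu => ((hmem u).1 hu).2.ne
      by_cases hl : lab ⟨k, hk⟩ = l
      · refine ⟨⟨k, hk⟩ :: c, List.nodup_cons.2 ⟨fun h => hlt _ h rfl, hnd⟩, fun u => ?_, ?_, ?_⟩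
        · rw [List.mem_cons, hmem, Nat.lt_succ_iff_lt_or_eq, Fin.ext_iff]
          constructor
          · rintro (h | ⟨h1, h2⟩)
            · obtain rfl : u = ⟨k, hk⟩ := Fin.ext h
              exact ⟨hl, .inr rfl⟩
            · exact ⟨h1, .inl h2⟩
          · tauto
        · simp [linkBody, Prog.run, NExp.eval, hi, ha', hak, hl]
        · simpa [linkBody, Prog.run, NExp.eval, hi, ha', hak, hl] using hlink.update hlt _
      · refine ⟨c, hnd, fun u => ?_, ?_⟩
        · rw [hmem, Nat.lt_succ_iff_lt_or_eq]
          refine and_congr_right fun hu => ⟨.inl, fun h => h.resolve_right fun h => hl ?_⟩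
          obtain rfl : u = ⟨k, hk⟩ := Fin.ext h
          exact hu
        · have : ¬ (l : ℕ) = lab ⟨k, hk⟩ := fun e => hl (Fin.ext e.symm)
          simpa [linkBody, Prog.run, NExp.eval, hi, ha', hak, this] using hlink.update hlt _
    · simp [NExp.cost]
      omega
    · intro l
      obtain ⟨c, hnd, hmem, hlink⟩ := h l
      exact ⟨c, hnd, fun u => by simp [hmem], hlink⟩

/-- Run through the linked list of the label `rLab`, with the position in `rLen` and the vertex in
`rCur`. -/
def Prog.forList (c : Prog ι) : Prog ι :=
  (.setReg rLen (.const 0) ;; .setReg rCur (.load aHead (.reg rLab))) ;;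
  .while (.nlt (.reg rCur) (.reg rSize))
    (c ;; (.setReg rLen (.add (.reg rLen) (.const 1)) ;; .setReg rCur (.load aNext (.reg rCur))))

@[simp] theorem Prog.forList_writesReg (c : Prog ι) (x : ℕ) :
    (Prog.forList c).WritesReg x ↔ x = rLen ∨ x = rCur ∨ c.WritesReg x := by
  simp only [Prog.forList, Prog.WritesReg]; tauto

@[simp] theorem Prog.forList_writesNat (c : Prog ι) (x : ℕ) :
    (Prog.forList c).WritesNat x ↔ c.WritesNat x := by
  simp only [Prog.forList, Prog.WritesNat]; tauto

@[simp] theorem Prog.forList_writesReal (c : Prog ι) (x : ℕ) :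
    (Prog.forList c).WritesReal x ↔ c.WritesReal x := by
  simp only [Prog.forList, Prog.WritesReal]; tauto

/-- The terminator `N` is the only pointer value that fails the loop test. The cost is linear in the
length of the list, so all classes together take linear time. -/
theorem Exec.forList {body : Prog ι} {B : ℕ} {s : State} {vs : List (Fin N)}
    (hN : s.reg rSize = N) (hc : IsLinked (s.nat aNext) (s.nat aHead (s.reg rLab)) vs)
    (hsize : ¬ body.WritesReg rSize) (hlen : ¬ body.WritesReg rLen) (hcur : ¬ body.WritesReg rCur)
    (hnext : ¬ body.WritesNat aNext) (I : ℕ → State → Prop)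
    (hI : ∀ k s m m', I k s → I k ((s.writeReg rLen m).writeReg rCur m')) (h0 : I 0 s)
    (hstep : ∀ k (hk : k < vs.length) (s' : State), Frame (Prog.forList body) s s' →
      s'.reg rLen = k → s'.reg rCur = vs[k] → I k s' → Exec prim body s' B (I (k + 1))) :
    Exec prim (Prog.forList body) s (vs.length * (B + 12) + 10)
      fun s' => I vs.length s' ∧ s'.reg rLen = vs.length := by
  let J : ℕ → State → Prop := fun k s' => I k s' ∧ s'.reg rLen = k ∧
    IsLinked (s.nat aNext) (s'.reg rCur) (vs.drop k) ∧ Frame (Prog.forList body) s s'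
  refine Exec.mono (Exec.seq_of (t := 5) (t' := (∑ _k ∈ Finset.range vs.length, (B + 8)) +
    (vs.length + 1) * 4) (R := J 0) ?_ ?_) ?_ fun _ h => h
  · refine (Exec.of_loopFree (by simp [Prog.LoopFree]) ?_).mono
      (by simp [Prog.maxCost, NExp.cost]) fun _ h => h
    refine ⟨hI _ _ _ _ h0, by simp [Prog.run, NExp.eval],
      by simpa [Prog.run, NExp.eval] using hc, fun x hx => ?_, fun _ _ => rfl, fun _ _ => rfl⟩
    simp only [Prog.forList_writesReg, not_or] at hx
    simp [Prog.run, hx]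
  · intro s₁ h₁
    refine (Exec.while_count (B := fun _ => B + 8) J h₁ ?_ ?_).mono (by simp [Test.cost, NExp.cost])
      fun s' h => ⟨h.1, h.2.1⟩
    · rintro k hk s' ⟨hIk, hlenk, hlink, hf⟩
      rw [List.drop_eq_getElem_cons hk] at hlink
      refine ⟨?_, ?_⟩
      · have := hf.reg rSize (by simp [hsize])
        simp [Test.Holds, NExp.eval, hlink.1, this, hN]
      · refine Exec.seq_of (hstep k hk s' hf hlenk hlink.1 hIk).frame (t' := 8) ?_
        rintro s₂ ⟨hI₂, hf₂⟩
        have hf₂' : Frame (Prog.forList body) s s₂ :=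
          hf.trans (hf₂.mono (by simp +contextual) (by simp +contextual) (by simp +contextual))
        refine (Exec.of_loopFree (by simp [Prog.LoopFree]) ?_).mono
          (by simp [Prog.maxCost, NExp.cost]) fun _ h => h
        refine ⟨hI _ _ _ _ hI₂, ?_, ?_, ?_⟩
        · simp [Prog.run, NExp.eval, hf₂.reg rLen hlen, hlenk]
        · simpa [Prog.run, NExp.eval, hf₂.reg rCur hcur, hf₂'.nat aNext (by simpa using hnext),
            hlink.1] using hlink.2
        · refine hf₂'.trans ⟨fun x hx => ?_, fun _ _ => rfl, fun _ _ => rfl⟩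
          simp only [Prog.forList_writesReg, not_or] at hx
          simp [Prog.run, hx]
    · rintro s' ⟨-, -, hlink, hf⟩
      rw [List.drop_length] at hlink
      have := hf.reg rSize (by simp [hsize])
      simp [Test.Holds, NExp.eval, this, hN, show s'.reg rCur = N from hlink]
  · simp only [Finset.sum_const, Finset.card_range, smul_eq_mul]
    ring_nf
    omega

end RealRAM

/-! ### Hub integrals by calls of the given program -/

namespace RealRAM

variable {ι : Type*} {prim : ι → ℝ → ℝ} {N : ℕ}

/-- First free number for the memory of a subprogram. -/
notation "subBase" => 12

/-- Copy the data of the current class to the input of the subprogram. -/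
def gatherBody : Prog ι :=
  .setReal 12 (.reg rLen) (.load aHub (.reg rCur)) ;;
  .setReal 13 (.reg rLen) (.load aHub (.reg rCur)) ;;
  .setReal 14 (.reg rLen) (.load aField (.reg rCur))

/-- Add the output of the subprogram, multiplied by `σ`, to the result. -/
def scatterBody (σ : ℝ) : Prog ι :=
  .incReal aRes (.reg rCur) (.mul (.const σ) (.load 15 (.reg rLen)))

def gather : Prog ι := .forList gatherBody

def scatter (σ : ℝ) : Prog ι := .forList (scatterBody σ)

/-- Multiply the matrix of the class `rLab` with the field, with the subprogram `P`. -/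
def multiplyClass (P : Prog ι) (σ : ℝ) : Prog ι :=
  (.setReg 12 (.reg rLen) ;; .setReg 13 (.reg rLen)) ;; P.shift subBase ;; scatter σ

def addClass (P : Prog ι) (σ : ℝ) : Prog ι :=
  gather ;; .ite (.nlt (.const 0) (.reg rLen)) (multiplyClass P σ) .skip

/-- Add the hub integral with respect to the labels in array `a`, multiplied by `σ`. -/
def addHubIntegral (P : Prog ι) (σ : ℝ) (a : ℕ) : Prog ι :=
  linkClasses a ;; .for rLab (.reg rSize) (addClass P σ)

section

variable {s : State} {vs : List (Fin N)} {h X : Fin N → ℝ}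

theorem exec_gather (hN : s.reg rSize = N)
    (hvs : IsLinked (s.nat aNext) (s.nat aHead (s.reg rLab)) vs)
    (hh : ∀ u : Fin N, s.real aHub u = h u) (hX : ∀ u : Fin N, s.real aField u = X u) :
    Exec prim (gather : Prog ι) s (vs.length * 24 + 10) fun s' =>
      (∀ i (hi : i < vs.length), s'.real 12 i = h vs[i] ∧ s'.real 13 i = h vs[i] ∧
        s'.real 14 i = X vs[i]) ∧ s'.reg rLen = vs.length := by
  refine (Exec.forList (B := 12) hN hvs (by simp [gatherBody, Prog.WritesReg])
    (by simp [gatherBody, Prog.WritesReg]) (by simp [gatherBody, Prog.WritesReg])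
    (by simp [gatherBody, Prog.WritesNat])
    (fun k s' => ∀ i (hi : i < vs.length), i < k → s'.real 12 i = h vs[i] ∧
      s'.real 13 i = h vs[i] ∧ s'.real 14 i = X vs[i]) ?_ ?_ ?_).mono le_rfl
    fun s' hs' => ⟨fun i hi => hs'.1 i hi hi, hs'.2⟩
  · intro k s m m' h
    simpa using h
  · intro i _ hi
    omega
  · intro k hk s' hf hlen hcur hI
    refine (Exec.of_loopFree (by simp [Prog.LoopFree, gatherBody]) ?_).mono
      (by simp [gatherBody, Prog.maxCost, NExp.cost, RExp.cost]) fun _ h => h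
    have e1 := hf.real aHub (by simp [gatherBody, Prog.WritesReal])
    have e2 := hf.real aField (by simp [gatherBody, Prog.WritesReal])
    intro i hi hik
    rcases Nat.lt_succ_iff_lt_or_eq.1 hik with hlt | rfl
    · simpa [gatherBody, Prog.run, NExp.eval, RExp.eval, hlen, hlt.ne] using hI i hi hlt
    · simp [gatherBody, Prog.run, NExp.eval, RExp.eval, hlen, hcur, e1, e2, hh, hX]

theorem exec_scatter {σ : ℝ} {z : ℕ → ℝ} (hN : s.reg rSize = N) (hnd : vs.Nodup)
    (hvs : IsLinked (s.nat aNext) (s.nat aHead (s.reg rLab)) vs)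
    (hz : ∀ i < vs.length, s.real 15 i = z i) :
    Exec prim (scatter σ : Prog ι) s (vs.length * 24 + 10) fun s' =>
      (∀ i (hi : i < vs.length), s'.real aRes vs[i] = s.real aRes vs[i] + σ * z i) ∧
      ∀ u : Fin N, u ∉ vs → s'.real aRes u = s.real aRes u := by
  refine (Exec.forList (B := 12) hN hvs (by simp [scatterBody, Prog.incReal, Prog.WritesReg])
    (by simp [scatterBody, Prog.incReal, Prog.WritesReg])
    (by simp [scatterBody, Prog.incReal, Prog.WritesReg])
    (by simp [scatterBody, Prog.incReal, Prog.WritesNat])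
    (fun k s' => (∀ i (hi : i < vs.length), s'.real aRes vs[i] = s.real aRes vs[i] +
      if i < k then σ * z i else 0) ∧ ∀ u : Fin N, u ∉ vs → s'.real aRes u = s.real aRes u)
      ?_ ?_ ?_).mono le_rfl fun s' hs' => ⟨fun i hi => ?_, hs'.1.2⟩
  · intro k s m m' h
    simpa using h
  · simp
  · intro k hk s' hf hlen hcur hI
    refine (Exec.of_loopFree (by simp [Prog.LoopFree, scatterBody, Prog.incReal]) ?_).mono
      (by simp [scatterBody, Prog.incReal, Prog.maxCost, NExp.cost, RExp.cost]) fun _ h => h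
    have e1 := hf.real 15 (by simp [scatterBody, Prog.incReal, Prog.WritesReal])
    refine ⟨fun i hi => ?_, fun u hu => ?_⟩
    -- Since the list has no duplicates, each cell is incremented in one round only.
    · simp only [scatterBody, Prog.incReal, Prog.run, NExp.eval, RExp.eval, hlen, hcur, e1,
        hz k hk, State.writeReal_real, if_true, update_add_apply, hI.1 i hi, Fin.val_inj,
        hnd.getElem_inj_iff]
      rcases lt_trichotomy i k with hlt | rfl | hgt
      · simp [hlt, hlt.ne', hlt.trans (Nat.lt_succ_self k)]
      · simp
      · simp [hgt.not_gt, hgt.ne, (Nat.succ_le_of_lt hgt).not_gt]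
    · have hne : vs[k] ≠ u := fun e => hu (e ▸ List.getElem_mem hk)
      simp only [scatterBody, Prog.incReal, Prog.run, NExp.eval, RExp.eval, hlen, hcur,
        State.writeReal_real, if_true, update_add_apply, hI.2 u hu, Fin.val_inj, hne, if_false,
        add_zero]
  · simpa [hi] using hs'.1.1 i hi

/-- Any enumeration of the class serves, since the order of the list permutes rows and columns
alike. -/
theorem hubIntegral_eq_mulVec (f : ℝ → ℝ) {lab : Fin N → Fin N} {l : Fin N} (hnd : vs.Nodup)
    (hmem : ∀ u, u ∈ vs ↔ lab u = l) (i : Fin vs.length) :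
    ((Matrix.of fun i j : Fin vs.length => f (h vs[i] + h vs[j])) *ᵥ fun j => X vs[j]) i =
      hubIntegral f h X lab vs[i] := by
  have hl : lab vs[i] = l := (hmem _).1 (List.getElem_mem _)
  have hset : Finset.univ.filter (fun v => lab v = l) = vs.toFinset := by
    ext u; simp [hmem]
  rw [hubIntegral, hl, hset, List.sum_toFinset _ hnd]
  simp only [Matrix.mulVec, dotProduct, Matrix.of_apply]
  exact Fin.sum_univ_fun_getElem vs (fun v => f (h vs[i] + h v) * X v)

variable {f : ℝ → ℝ} {P : Prog ι} {T : ℕ → ℕ} {r : ℕ}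

/-- The given program is called with both sequences equal to the hub distances of the class, hence
with `a + b = 2 * n` for a class of `n` vertices. -/
theorem exec_addClass (hP : MultipliesSumMatrices prim f P T)
    (hT : ∀ n, 1 ≤ n → n ≤ N → T (n + n) ≤ n * r) (σ : ℝ) {lab : Fin N → Fin N} {l : Fin N}
    (hN : s.reg rSize = N)
    (hvs : IsLinked (s.nat aNext) (s.nat aHead (s.reg rLab)) vs) (hnd : vs.Nodup)
    (hmem : ∀ u, u ∈ vs ↔ lab u = l)
    (hh : ∀ u : Fin N, s.real aHub u = h u) (hX : ∀ u : Fin N, s.real aField u = X u) :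
    Exec prim (addClass P σ) s (vs.length * (50 + r) + 40) fun s' => ∀ u : Fin N,
      s'.real aRes u = s.real aRes u + if lab u = l then σ * hubIntegral f h X lab u else 0 := by
  refine Exec.mono (Exec.seq_of (exec_gather hN hvs hh hX).frame
    (t' := vs.length * (26 + r) + 30) ?_) (by ring_nf; omega) fun _ h => h
  rintro s₁ ⟨⟨hcopy, hlen⟩, hf₁⟩
  have hres : s₁.real aRes = s.real aRes :=
    hf₁.real aRes (by simp [gather, gatherBody, Prog.WritesReal])
  -- The given program is specified only for nonempty sequences, whereas a label may be carried by
  -- no vertex.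
  by_cases hpos : 0 < vs.length
  · refine Exec.mono (c := .ite (.nlt (.const 0) (.reg rLen)) (multiplyClass P σ) .skip)
      (t := 4 + (vs.length * (26 + r) + 20)) ?_ (by omega) fun _ h => h
    have hinput : StoresSumMatrixInput
        (((s₁.writeReg 12 vs.length).writeReg 13 vs.length).view subBase)
        (fun i : Fin vs.length => h vs[i]) (fun i : Fin vs.length => h vs[i])
        (fun i : Fin vs.length => X vs[i]) := by
      constructor
      · simp [State.view]
      · simp [State.view]
      · simpa [State.view] using fun i : Fin vs.length => (hcopy i i.2).1
      · simpa [State.view] using fun i : Fin vs.length => (hcopy i i.2).2.1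
      · simpa [State.view] using fun i : Fin vs.length => (hcopy i i.2).2.2
    obtain ⟨t, v', hrun, ht, hout⟩ := hP _ _ hpos hpos _ _ _ _ hinput
    obtain ⟨s₂, hrun₂, rfl⟩ := hrun.shift subBase _ rfl
    have hf₂ := hrun₂.frame
    have hlow : ∀ x < 12, s₂.reg x = s₁.reg x ∧ s₂.nat x = s₁.nat x ∧ s₂.real x = s₁.real x :=
      fun x hx => ⟨by
        rw [hf₂.reg x (Prog.shift_writesReg_lt hx P)]
        simp [hx.ne, (show x ≠ 13 by omega)], by
        rw [hf₂.nat x (Prog.shift_writesNat_lt hx P)]; rfl, by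
        rw [hf₂.real x (Prog.shift_writesReal_lt hx P)]; rfl⟩
    have hsc := exec_scatter (prim := prim) (ι := ι) (σ := σ) (s := s₂) (vs := vs)
      -- The default 0 is never used; it only makes `z` a total function.
      (z := fun i => if hi : i < vs.length then hubIntegral f h X lab vs[i] else 0)
      (by rw [(hlow rSize (by norm_num)).1,
            hf₁.reg rSize (by simp [gather, gatherBody, Prog.WritesReg]), hN]) hnd
      (by rw [(hlow aNext (by norm_num)).2.1, (hlow aHead (by norm_num)).2.1,
            (hlow rLab (by norm_num)).1,
            hf₁.reg rLab (by simp [gather, gatherBody, Prog.WritesReg]),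
            hf₁.nat aNext (by simp [gather, gatherBody, Prog.WritesNat]),
            hf₁.nat aHead (by simp [gather, gatherBody, Prog.WritesNat])]
          exact hvs)
      (fun i hi => by
        rw [dif_pos hi]
        exact (hout ⟨i, hi⟩).trans (hubIntegral_eq_mulVec f hnd hmem ⟨i, hi⟩))
    have hset : Runs prim (.setReg 12 (.reg rLen) ;; .setReg 13 (.reg rLen)) s₁ 4
        ((s₁.writeReg 12 vs.length).writeReg 13 vs.length) := by
      simpa [NExp.eval, NExp.cost, hlen] using
        Runs.seq (prim := prim) (.setReg s₁ 12 (.reg rLen)) (.setReg _ 13 (.reg rLen))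
    obtain ⟨t₃, s₃, hrun₃, ht₃, hin, hout⟩ := hsc
    refine ⟨_, s₃, .iteTrue (by simpa [Test.Holds, NExp.eval, hlen] using hpos)
      (.seq hset (.seq hrun₂ hrun₃)), ?_, fun u => ?_⟩
    · have hle : vs.length ≤ N := by simpa using hnd.length_le_card
      have := hT _ hpos hle
      simp only [Test.cost, NExp.cost]
      have e : vs.length * (26 + r) = vs.length * 24 + vs.length * 2 + vs.length * r := by ring
      omega
    · by_cases hu : lab u = l
      · obtain ⟨i, hi, rfl⟩ := List.getElem_of_mem ((hmem u).2 hu)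
        rw [hin i hi, dif_pos hi, if_pos hu, (hlow aRes (by norm_num)).2.2, hres]
      · rw [hout u (fun h => hu ((hmem u).1 h)), if_neg hu, (hlow aRes (by norm_num)).2.2, hres,
          add_zero]
  · refine ⟨_, s₁, .iteFalse (by simpa [Test.Holds, NExp.eval, hlen] using hpos) (.skip _), ?_,
      fun u => ?_⟩
    · simp only [Test.cost, NExp.cost]; omega
    · have : lab u ≠ l := fun hu => by
        have := List.length_pos_of_mem ((hmem u).2 hu)
        omega
      rw [if_neg this, hres, add_zero]

theorem exec_addHubIntegral (hP : MultipliesSumMatrices prim f P T)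
    (hT : ∀ n, 1 ≤ n → n ≤ N → T (n + n) ≤ n * r) (σ : ℝ) {a : ℕ} (ha : a < 10)
    {lab : Fin N → Fin N} (hN : s.reg rSize = N) (hlab : ∀ u : Fin N, s.nat a u = lab u)
    (hh : ∀ u : Fin N, s.real aHub u = h u) (hX : ∀ u : Fin N, s.real aField u = X u) :
    Exec prim (addHubIntegral P σ a) s (N * (150 + r) + 40) fun s' => ∀ u : Fin N,
      s'.real aRes u = s.real aRes u + σ * hubIntegral f h X lab u := by
  refine Exec.mono (Exec.seq_of (exec_linkClasses (by omega) (by omega) hN hlab).frame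
    (t' := N * (110 + r) + 20) ?_) (by ring_nf; omega) fun _ h => h
  rintro s₁ ⟨hlink, hf₁⟩
  have hN₁ : s₁.reg rSize = N := by
    rw [hf₁.reg rSize (by simp [linkClasses, clearHeads, linkBody, Prog.WritesReg]), hN]
  have hw : ∀ x, ¬ (linkClasses a : Prog ι).WritesReal x := by
    simp [linkClasses, clearHeads, linkBody, Prog.WritesReal]
  refine (Exec.for (n := N)
    -- The budget of a label is proportional to the size of its class, up to a constant. The classes
    -- partition the vertices, so the sum is linear in `N`.
    (B := fun k => (Finset.univ.filter fun u => (lab u : ℕ) = k).card * (50 + r) + 40)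
    (fun k s' => ∀ u : Fin N, s'.real aRes u = s.real aRes u +
      if (lab u : ℕ) < k then σ * hubIntegral f h X lab u else 0) ?_ ?_ ?_ ?_ ?_).mono ?_ ?_
  · intro s' hf
    have := hf.reg rSize (by simp [addClass, multiplyClass, gather, gatherBody, scatter,
      scatterBody, Prog.incReal, Prog.WritesReg, Prog.shift_writesReg_lt])
    simp [NExp.eval, this, hN₁]
  · simp [addClass, multiplyClass, gather, gatherBody, scatter,
      scatterBody, Prog.incReal, Prog.WritesReg, Prog.shift_writesReg_lt]
  · intro k s m h
    simpa using h
  · intro u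
    simp [hf₁.real _ (hw _)]
  · intro k hk s' hf hlabk hI
    obtain ⟨vs, hnd, hmem, hvs⟩ := hlink ⟨k, hk⟩
    have e0 := hf.reg rSize (by simp [addClass, multiplyClass, gather, gatherBody, scatter,
      scatterBody, Prog.incReal, Prog.WritesReg, Prog.shift_writesReg_lt])
    have e1 := hf.nat aNext (by simp [addClass, multiplyClass, gather, gatherBody, scatter,
      scatterBody, Prog.incReal, Prog.WritesNat, Prog.shift_writesNat_lt])
    have e2 := hf.nat aHead (by simp [addClass, multiplyClass, gather, gatherBody, scatter,
      scatterBody, Prog.incReal, Prog.WritesNat, Prog.shift_writesNat_lt])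
    have e3 := hf.real aHub (by simp [addClass, multiplyClass, gather, gatherBody, scatter,
      scatterBody, Prog.incReal, Prog.WritesReal, Prog.shift_writesReal_lt])
    have e4 := hf.real aField (by simp [addClass, multiplyClass, gather, gatherBody, scatter,
      scatterBody, Prog.incReal, Prog.WritesReal, Prog.shift_writesReal_lt])
    have hcard : (Finset.univ.filter fun u => (lab u : ℕ) = k).card = vs.length := by
      rw [← List.toFinset_card_of_nodup hnd]
      congr 1
      ext u
      simp [hmem, Fin.ext_iff]
    rw [hcard]
    refine (exec_addClass hP hT σ (e0.trans hN₁) (by rw [e1, e2, hlabk]; exact hvs) hnd hmem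
      (fun u => by rw [e3, hf₁.real _ (hw _), hh]) (fun u => by rw [e4, hf₁.real _ (hw _), hX])).mono
      le_rfl fun s'' hs'' u => ?_
    rw [hs'' u, hI u, add_assoc]
    congr 1
    simp only [Fin.ext_iff]
    rcases lt_trichotomy (lab u : ℕ) k with hlt | heq | hgt
    · simp [hlt, hlt.ne, hlt.trans (Nat.lt_succ_self k)]
    · simp [heq]
    · simp [hgt.not_gt, hgt.ne', (Nat.succ_le_of_lt hgt).not_gt]
  · have hsum : ∑ k ∈ Finset.range N, (Finset.univ.filter fun u => (lab u : ℕ) = k).card = N := by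
      have := Finset.card_eq_sum_card_fiberwise (s := Finset.univ) (t := Finset.range N)
        (f := fun u => (lab u : ℕ)) fun u _ => by simp
      simpa using this.symm
    rw [Finset.sum_add_distrib, ← Finset.sum_mul, hsum]
    simp [NExp.cost]
    ring_nf
    omega
  · intro s' hs' u
    simpa using hs' u

end

end RealRAM

notation "rComps" => 1
notation "rComp" => 2
notation "rAddr" => 3
notation "rPow" => 4

notation "aInput" => 1
notation "aOutput" => 2

namespace RealRAM

variable {ι : Type*} {prim : ι → ℝ → ℝ} {N : ℕ}

/-! ### One round: halving all classes -/

/-- The memory holds a weighted tree. -/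
structure StoresTree (s : State) (G : SimpleGraph (Fin N)) (w : Sym2 (Fin N) → ℝ) : Prop where
  size : s.reg rSize = N
  edges : ∃ src dst : Fin (N - 1) → Fin N,
    Set.range (fun k => s(src k, dst k)) = G.edgeSet ∧
    ∀ k : Fin (N - 1), s.nat aSrc k = src k ∧ s.nat aDst k = dst k ∧
      s.real aEdgeW k = w s(src k, dst k)

theorem StoresTree.congr {s s' : State} {G : SimpleGraph (Fin N)} {w : Sym2 (Fin N) → ℝ}
    (h : StoresTree s G w) (h1 : s'.reg rSize = s.reg rSize) (h2 : s'.nat aSrc = s.nat aSrc)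
    (h3 : s'.nat aDst = s.nat aDst) (h4 : s'.real aEdgeW = s.real aEdgeW) : StoresTree s' G w :=
  ⟨h1.trans h.size, by simpa only [h2, h3, h4] using h.edges⟩

/-- Split the classes at their centroids. -/
def splitClasses : Prog ι := initArrays ;; countClasses ;; scanEdges ;; peel ;; relabel

section

variable {s : State} {G : SimpleGraph (Fin N)} {w : Sym2 (Fin N) → ℝ} {lab : Fin N → Fin N}

theorem exec_splitClasses (hG : G.IsTree) (ht : StoresTree s G w)
    (hlab : ∀ u : Fin N, s.nat aLab u = lab u) (hspan : SpansTrees G lab) :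
    Exec prim (splitClasses : Prog ι) s (400 * N + 100) fun s' =>
      ∃ (h : Fin N → ℝ) (nl : Fin N → Fin N), IsHalving G w lab nl h ∧
        ∀ u : Fin N, s'.real aHub u = h u ∧ s'.nat aNewLab u = nl u := by
  refine Exec.mono (t := (40 * N + 6) + ((20 * N + 6) + ((80 * N + 10) + ((200 * N + 20) +
    (50 * N + 10))))) ?_ (by omega) fun _ h => h
  refine Exec.seq_of (exec_initArrays ht.size).frame ?_
  rintro s₁ ⟨h₁, f₁⟩
  have N₁ : s₁.reg rSize = N := by
    rw [f₁.reg rSize (by simp [initArrays, initBody, Prog.WritesReg]), ht.size]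
  have hlab₁ : ∀ u : Fin N, s₁.nat aLab u = lab u := fun u => by
    rw [f₁.nat aLab (by simp [initArrays, initBody, Prog.WritesNat]), hlab]
  refine Exec.seq_of (exec_countClasses N₁ hlab₁ fun u hu => (h₁ u hu).1).frame ?_
  rintro s₂ ⟨h₂, f₂⟩
  have nat₂ : ∀ a, a ≠ aClassSize → s₂.nat a = s₁.nat a := fun a ha =>
    f₂.nat a (by simpa [countClasses, countBody, Prog.incNat, Prog.WritesNat] using ha)
  have real₂ : ∀ a, s₂.real a = s₁.real a := fun a =>
    f₂.real a (by simp [countClasses, countBody, Prog.incNat, Prog.WritesReal])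
  have N₂ : s₂.reg rSize = N := by
    rw [f₂.reg rSize (by simp [countClasses, countBody, Prog.incNat, Prog.WritesReg]), N₁]
  refine Exec.seq_of (exec_scanEdges N₂ fun u hu => ?_).frame ?_
  · rw [nat₂ _ (by norm_num), nat₂ _ (by norm_num), real₂]
    exact ⟨(h₁ u hu).2.1, (h₁ u hu).2.2.1, (h₁ u hu).2.2.2.2.2.2.1⟩
  rintro s₃ ⟨h₃, f₃⟩
  have nat₃ : ∀ a, a ≠ aDeg → a ≠ aNbSum → s₃.nat a = s₂.nat a := fun a ha hb =>
    f₃.nat a (by simp [scanEdges, edgeBody, Prog.incNat, Prog.incReal, Prog.WritesNat, ha, hb])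
  have real₃ : ∀ a, a ≠ aNbW → s₃.real a = s₂.real a := fun a ha =>
    f₃.real a (by simp [scanEdges, edgeBody, Prog.incNat, Prog.incReal, Prog.WritesReal, ha])
  have N₃ : s₃.reg rSize = N := by
    rw [f₃.reg rSize (by simp [scanEdges, edgeBody, Prog.incNat, Prog.incReal, Prog.WritesReg]), N₂]
  obtain ⟨src, dst, hrange, hedge⟩ := ht.edges
  have hsrc : ∀ k : Fin (N - 1), s₂.nat aSrc k = src k := fun k => by
    rw [nat₂ _ (by norm_num), f₁.nat aSrc (by simp [initArrays, initBody, Prog.WritesNat]),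
      (hedge k).1]
  have hdst : ∀ k : Fin (N - 1), s₂.nat aDst k = dst k := fun k => by
    rw [nat₂ _ (by norm_num), f₁.nat aDst (by simp [initArrays, initBody, Prog.WritesNat]),
      (hedge k).2.1]
  have hwt : ∀ k : Fin (N - 1), s₂.real aEdgeW k = w s(src k, dst k) := fun k => by
    rw [real₂, f₁.real aEdgeW (by simp [initArrays, initBody, Prog.WritesReal]), (hedge k).2.2]
  have hlab₂ : ∀ u : Fin N, s₂.nat aLab u = lab u := fun u => by
    rw [nat₂ _ (by norm_num), hlab₁]
  have hP := Peeling.init (w := w) hspan (fun u => s₃.real aParW u)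
  have hdeg : ∀ u : Fin N, s₃.nat aDeg u = (labelNbs G lab [] u).card := fun u => by
    rw [(h₃ u u.2).1, Finset.card_eq_sum_ones, ← sum_edge_list_eq hG hrange, Finset.sum_range]
    simp only [hsrc, hdst, hlab₂, Fin.val_inj]
  have hns : ∀ u : Fin N, s₃.nat aNbSum u = ∑ x ∈ labelNbs G lab [] u, (x : ℕ) := fun u => by
    rw [(h₃ u u.2).2.1, ← sum_edge_list_eq hG hrange, Finset.sum_range]
    simp only [hsrc, hdst, hlab₂, Fin.val_inj]
  have hws : ∀ u : Fin N, s₃.real aNbW u = ∑ x ∈ labelNbs G lab [] u, w s(u, x) := fun u => by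
    rw [(h₃ u u.2).2.2, ← sum_edge_list_eq hG hrange, Finset.sum_range]
    simp only [hsrc, hdst, hlab₂, hwt, Fin.val_inj]
    refine Finset.sum_congr rfl fun k _ => if_congr Iff.rfl (congrArg₂ _ ?_ ?_) rfl
    · split_ifs with e
      · rw [e]
      · rfl
    · split_ifs with e
      · rw [e, Sym2.eq_swap]
      · rfl
  have hinit : ∀ u : Fin N, s₃.nat aAcc u = 1 ∧ s₃.nat aPar u = u ∧ s₃.nat aNewLab u = u ∧
      s₃.real aHub u = 0 := fun u => by
    obtain ⟨-, -, -, i1, i2, i3, -, i4⟩ := h₁ u u.2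
    rw [nat₃ _ (by norm_num) (by norm_num), nat₃ _ (by norm_num) (by norm_num),
      nat₃ _ (by norm_num) (by norm_num), real₃ _ (by norm_num), nat₂ _ (by norm_num),
      nat₂ _ (by norm_num), nat₂ _ (by norm_num), real₂]
    exact ⟨i1, i2, i3, i4⟩
  have hS : StoresPeeling (s₃.writeReg rCnt 0) lab [] (fun u => (labelNbs G lab [] u).card)
      (fun u => ∑ x ∈ labelNbs G lab [] u, (x : ℕ)) (fun _ => 1)
      (fun u => ∑ x ∈ labelNbs G lab [] u, w s(u, x)) (fun u => s₃.real aParW u) id := by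
    refine ⟨by simpa using N₃, by simp, trivial, fun u => ?_, fun l => ?_, hdeg, hns,
      fun u => (hinit u).1, fun u => (hinit u).2.1, hws, fun _ => rfl⟩
    · rw [State.writeReg_nat, nat₃ _ (by norm_num) (by norm_num), hlab₂]
    · rw [State.writeReg_nat, nat₃ _ (by norm_num) (by norm_num), h₂]
  refine Exec.seq_of (exec_peel hP hS).frame ?_
  rintro s₄ ⟨⟨R, deg, ns, acc, ws, pw, par, hP, hS, hstuck⟩, f₄⟩
  refine (exec_relabel hP hS fun u => ?_).mono le_rfl ?_
  · rw [f₄.real aHub (by simp [peel, peelLeaf, nextVertex, Prog.WritesReal]),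
      f₄.nat aNewLab (by simp [peel, peelLeaf, nextVertex, Prog.WritesNat])]
    exact ⟨(hinit u).2.2.2, (hinit u).2.2.1⟩
  · rintro s₅ ⟨h, nl, hmem, i1, i2, i3, i4⟩
    exact ⟨h, nl, hP.isHalving hG hstuck i1 i2 i3 i4, hmem⟩

def copyLabels : Prog ι :=
  .for rIdx (.reg rSize) (.setNat aLab (.reg rIdx) (.load aNewLab (.reg rIdx)))

theorem exec_copyLabels {nl : Fin N → Fin N} (hN : s.reg rSize = N)
    (hnl : ∀ u : Fin N, s.nat aNewLab u = nl u) :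
    Exec prim (copyLabels : Prog ι) s (20 * N + 10) fun s' =>
      ∀ u : Fin N, s'.nat aLab u = nl u := by
  refine (Exec.for (n := N) (B := fun _ => 4) (fun k s' => ∀ u : Fin N, (u : ℕ) < k →
    s'.nat aLab u = nl u) ?_ ?_ ?_ ?_ ?_).mono ?_ fun s' h u => h u u.2
  · intro s' hf
    simp [NExp.eval, hf.reg rSize (by simp [Prog.WritesReg]), hN]
  · simp [Prog.WritesReg]
  · intro k s m h
    simpa using h
  · simp
  · intro k hk s' hf hi hI
    refine (Exec.of_loopFree (by simp [Prog.LoopFree]) ?_).mono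
      (by simp [Prog.maxCost, NExp.cost]) fun _ h => h
    intro u hu
    have hnl' := hf.nat aNewLab (by simp [Prog.WritesNat])
    rcases Nat.lt_succ_iff_lt_or_eq.1 hu with h | rfl
    · simpa [Prog.run, NExp.eval, hi, h.ne] using hI u h
    · simp [Prog.run, NExp.eval, hi, hnl', hnl]
  · simp [NExp.cost]
    omega

/-- Split all classes and account for the pairs of vertices that are separated. -/
def round (P : Prog ι) : Prog ι :=
  splitClasses ;; addHubIntegral P 1 aLab ;; addHubIntegral P (-1) aNewLab ;; copyLabels

theorem splitClasses_writesReg {x : ℕ} (h : x ≠ 5) (h' : x ≠ 6) (h'' : x ≠ 7) (h3 : x ≠ 8) :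
    ¬ (splitClasses : Prog ι).WritesReg x := by
  simp [splitClasses, initArrays, initBody, countClasses, countBody, scanEdges, edgeBody, peel,
    peelLeaf, nextVertex, relabel, popVertex, Prog.incNat, Prog.incReal, Prog.WritesReg, *]

theorem splitClasses_writesNat {a : ℕ} (h : a < 3) : ¬ (splitClasses : Prog ι).WritesNat a := by
  simp [splitClasses, initArrays, initBody, countClasses, countBody, scanEdges, edgeBody, peel,
    peelLeaf, nextVertex, relabel, popVertex, Prog.incNat, Prog.incReal, Prog.WritesNat]
  omega

theorem splitClasses_writesReal {a : ℕ} (h : a ≠ aNbW) (h' : a ≠ aParW) (h'' : a ≠ aHub) :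
    ¬ (splitClasses : Prog ι).WritesReal a := by
  simp [splitClasses, initArrays, initBody, countClasses, countBody, scanEdges, edgeBody, peel,
    peelLeaf, nextVertex, relabel, popVertex, Prog.incNat, Prog.incReal, Prog.WritesReal, *]

theorem addHubIntegral_writesReg {P : Prog ι} {σ : ℝ} {a x : ℕ} (h : x < 5) :
    ¬ (addHubIntegral P σ a).WritesReg x := by
  have := Prog.shift_writesReg_lt (show x < 12 by omega) P
  simp [addHubIntegral, linkClasses, clearHeads, linkBody, addClass, multiplyClass, gather,
    gatherBody, scatter, scatterBody, Prog.incReal, Prog.WritesReg, this]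
  omega

theorem addHubIntegral_writesNat {P : Prog ι} {σ : ℝ} {a x : ℕ} (h : x < 10) :
    ¬ (addHubIntegral P σ a).WritesNat x := by
  have := Prog.shift_writesNat_lt (show x < 12 by omega) P
  simp [addHubIntegral, linkClasses, clearHeads, linkBody, addClass, multiplyClass, gather,
    gatherBody, scatter, scatterBody, Prog.incReal, Prog.WritesNat, this]
  omega

theorem addHubIntegral_writesReal {P : Prog ι} {σ : ℝ} {a x : ℕ} (h : x < 7) :
    ¬ (addHubIntegral P σ a).WritesReal x := by
  have := Prog.shift_writesReal_lt (show x < 12 by omega) P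
  simp [addHubIntegral, linkClasses, clearHeads, linkBody, addClass, multiplyClass, gather,
    gatherBody, scatter, scatterBody, Prog.incReal, Prog.WritesReal, this]
  omega

variable {f : ℝ → ℝ} {P : Prog ι} {T : ℕ → ℕ} {r : ℕ} {X : Fin N → ℝ}

/-- The hub integral over the old classes is added and that over the new ones subtracted, which pays
exactly for the loss in the class integral. This gives the invariant without ever listing the
separated pairs. -/
theorem exec_round (hP : MultipliesSumMatrices prim f P T)
    (hT : ∀ n, 1 ≤ n → n ≤ N → T (n + n) ≤ n * r) (hG : G.IsTree) (ht : StoresTree s G w)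
    (hlab : ∀ u : Fin N, s.nat aLab u = lab u) (hspan : SpansTrees G lab)
    (hX : ∀ u : Fin N, s.real aField u = X u) :
    Exec prim (round P) s (N * (800 + 2 * r) + 300) fun s' => ∃ nl : Fin N → Fin N,
      (∀ u : Fin N, s'.nat aLab u = nl u) ∧ SpansTrees G nl ∧
      (∀ u, Finset.card {x | nl x = nl u} ≤ max 1 (Finset.card {x | lab x = lab u} / 2)) ∧
      ∀ u : Fin N, s'.real aRes u + classIntegral G w f X nl u =
        s.real aRes u + classIntegral G w f X lab u := by
  refine Exec.mono (t := (400 * N + 100) + ((N * (150 + r) + 40) + ((N * (150 + r) + 40) +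
    (20 * N + 10)))) ?_ (by ring_nf; omega) fun _ h => h
  refine Exec.seq_of (exec_splitClasses hG ht hlab hspan).frame ?_
  rintro s₁ ⟨⟨h, nl, hh, hmem⟩, f₁⟩
  have N₁ : s₁.reg rSize = N := by
    rw [f₁.reg rSize (splitClasses_writesReg (by norm_num) (by norm_num) (by norm_num)
      (by norm_num)), ht.size]
  refine Exec.seq_of (exec_addHubIntegral hP hT 1 (by norm_num) N₁ (lab := lab) (h := h) (X := X)
    (fun u => ?_) (fun u => (hmem u).1) (fun u => ?_)).frame ?_
  · rw [f₁.nat _ (splitClasses_writesNat (by norm_num)), hlab]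
  · rw [f₁.real _ (splitClasses_writesReal (by norm_num) (by norm_num) (by norm_num)), hX]
  rintro s₂ ⟨h₂, f₂⟩
  refine Exec.seq_of (exec_addHubIntegral hP hT (-1) (by norm_num) (lab := nl) (h := h) (X := X)
    ?_ (fun u => ?_) (fun u => ?_) (fun u => ?_)).frame ?_
  · rw [f₂.reg _ (addHubIntegral_writesReg (by norm_num)), N₁]
  · rw [f₂.nat _ (addHubIntegral_writesNat (by norm_num)), (hmem u).2]
  · rw [f₂.real _ (addHubIntegral_writesReal (by norm_num)), (hmem u).1]
  · rw [f₂.real _ (addHubIntegral_writesReal (by norm_num)),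
      f₁.real _ (splitClasses_writesReal (by norm_num) (by norm_num) (by norm_num)), hX]
  rintro s₃ ⟨h₃, f₃⟩
  refine (exec_copyLabels (nl := nl) ?_ fun u => ?_).frame.mono le_rfl ?_
  · rw [f₃.reg _ (addHubIntegral_writesReg (by norm_num)),
      f₂.reg _ (addHubIntegral_writesReg (by norm_num)), N₁]
  · rw [f₃.nat _ (addHubIntegral_writesNat (by norm_num)),
      f₂.nat _ (addHubIntegral_writesNat (by norm_num)), (hmem u).2]
  · rintro s₄ ⟨h₄, f₄⟩
    refine ⟨nl, h₄, hh.spans, hh.card_le, fun u => ?_⟩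
    rw [f₄.real _ (by simp [copyLabels, Prog.WritesReal]), h₃ u, h₂ u,
      f₁.real _ (splitClasses_writesReal (by norm_num) (by norm_num) (by norm_num)),
      hh.classIntegral_eq f X u]
    ring

end

end RealRAM

namespace RealRAM

variable {ι : Type*} {prim : ι → ℝ → ℝ} {N : ℕ}

/-! ### One component of the field -/

def rounds (P : Prog ι) : Prog ι :=
  .setReg rPow (.const 1) ;;
    .while (.nlt (.reg rPow) (.reg rSize)) (round P ;; .setReg rPow (.add (.reg rPow) (.reg rPow)))

/-- Copy a component of the field and start with a single class. -/
def loadBody (z : ℝ) : Prog ι :=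
  .setReal aField (.reg rIdx) (.load aInput (.reg rAddr)) ;;
  .setReal aRes (.reg rIdx) (.mul (.const z) (.load aInput (.reg rAddr))) ;;
  .setNat aLab (.reg rIdx) (.const 0) ;;
  .setReg rAddr (.add (.reg rAddr) (.reg rComps))

def loadField (z : ℝ) : Prog ι :=
  .setReg rAddr (.reg rComp) ;; .for rIdx (.reg rSize) (loadBody z)

def storeBody : Prog ι :=
  .setReal aOutput (.reg rAddr) (.load aRes (.reg rIdx)) ;;
  .setReg rAddr (.add (.reg rAddr) (.reg rComps))

def storeField : Prog ι := .setReg rAddr (.reg rComp) ;; .for rIdx (.reg rSize) storeBody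

/-- Integration of a field on a tree, with a subprogram `P` for the matrices `[f (x i + y j)]` and
`z = f 0`. -/
def integrate (P : Prog ι) (z : ℝ) : Prog ι :=
  .for rComp (.reg rComps) (loadField z ;; rounds P ;; storeField)

theorem round_writesReg {P : Prog ι} {x : ℕ} (h : x < 5) : ¬ (round P).WritesReg x := by
  simp [round, Prog.WritesReg, addHubIntegral_writesReg h, copyLabels,
    splitClasses_writesReg (show x ≠ 5 by omega) (show x ≠ 6 by omega) (show x ≠ 7 by omega)
      (show x ≠ 8 by omega)]
  omega

theorem round_writesNat {P : Prog ι} {x : ℕ} (h : x < 2) : ¬ (round P).WritesNat x := by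
  simp [round, Prog.WritesNat, addHubIntegral_writesNat (show x < 10 by omega), copyLabels,
    splitClasses_writesNat (show x < 3 by omega)]
  omega

theorem round_writesReal {P : Prog ι} {x : ℕ} (h : x < 3) : ¬ (round P).WritesReal x := by
  simp [round, Prog.WritesReal, addHubIntegral_writesReal (show x < 7 by omega), copyLabels,
    splitClasses_writesReal (show x ≠ 3 by omega) (show x ≠ 4 by omega) (show x ≠ 5 by omega)]

theorem round_writesReal_field {P : Prog ι} : ¬ (round P).WritesReal aField := by
  simp [round, Prog.WritesReal, addHubIntegral_writesReal (show 6 < 7 by omega), copyLabels,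
    splitClasses_writesReal (show 6 ≠ 3 by omega) (show 6 ≠ 4 by omega) (show 6 ≠ 5 by omega)]

section

variable {s : State} {G : SimpleGraph (Fin N)} {w : Sym2 (Fin N) → ℝ}
  {f : ℝ → ℝ} {P : Prog ι} {T : ℕ → ℕ} {r : ℕ} {X : Fin N → ℝ}

/-- The diagonal is put in at the start as `f 0 * X`. It plays the role of the class integral left
over when all classes are single vertices, and cancels against it. -/
theorem exec_rounds (hP : MultipliesSumMatrices prim f P T)
    (hT : ∀ n, 1 ≤ n → n ≤ N → T (n + n) ≤ n * r) (hG : G.IsTree) (ht : StoresTree s G w)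
    (hlab : ∀ u : Fin N, s.nat aLab u = 0)
    (hX : ∀ u : Fin N, s.real aField u = X u) (hres : ∀ u : Fin N, s.real aRes u = f 0 * X u) :
    Exec prim (rounds P) s (Nat.clog 2 N * (N * (800 + 2 * r) + 310) + 10) fun s' =>
      ∀ u : Fin N, s'.real aRes u = (fDistanceMatrix G w f *ᵥ X) u := by
  obtain ⟨root⟩ : Nonempty (Fin N) := hG.1.nonempty
  have hpos : 0 < N := root.pos
  let c : Fin N := ⟨0, hpos⟩
  let I : ℕ → State → Prop := fun k s' => s'.reg rPow = 2 ^ k ∧ StoresTree s' G w ∧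
    (∀ u : Fin N, s'.real aField u = X u) ∧ ∃ lab : Fin N → Fin N,
      (∀ u : Fin N, s'.nat aLab u = lab u) ∧ SpansTrees G lab ∧
      (∀ u, Finset.card {x | lab x = lab u} ≤ max 1 (N / 2 ^ k)) ∧
      ∀ u : Fin N, s'.real aRes u + classIntegral G w f X lab u =
        f 0 * X u + (fDistanceMatrix G w f *ᵥ X) u
  refine Exec.mono (Exec.seq_of (t := 2) (t' :=
    (∑ _k ∈ Finset.range (Nat.clog 2 N), (N * (800 + 2 * r) + 304)) + (Nat.clog 2 N + 1) * 4)
    (R := I 0) ?_ ?_) ?_ fun _ h => h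
  · refine (Exec.of_loopFree (by simp [Prog.LoopFree]) ?_).mono
      (by simp [Prog.maxCost, NExp.cost]) fun _ h => h
    refine ⟨by simp [Prog.run, NExp.eval], ht.congr ?_ rfl rfl rfl, hX, fun _ => c, hlab,
      hG.spansTrees_const c, ?_, ?_⟩
    · simp [Prog.run]
    · simp
    · intro u
      rw [classIntegral_const]
      exact congrArg (· + _) (hres u)
  · intro s₁ h₁
    refine (Exec.while_count (n := Nat.clog 2 N) (B := fun _ => N * (800 + 2 * r) + 304) I h₁ ?_ ?_).mono
      (by simp [Test.cost, NExp.cost]) ?_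
    · rintro k hk s' ⟨hpow, ht, hX, lab, hlab, hspan, hcard, hres⟩
      have hlt := (Nat.lt_clog_iff_pow_lt (by norm_num)).1 hk
      refine ⟨by simpa [Test.Holds, NExp.eval, hpow, ht.size] using hlt, ?_⟩
      refine Exec.seq_of (exec_round hP hT hG ht hlab hspan hX).frame (t' := 4) ?_
      rintro s₂ ⟨⟨nl, h1, h2, h3, h4⟩, f₂⟩
      refine (Exec.of_loopFree (by simp [Prog.LoopFree]) ?_).mono
        (by simp [Prog.maxCost, NExp.cost]) fun _ h => h
      refine ⟨?_, ht.congr ?_ ?_ ?_ ?_, fun u => ?_, nl, h1, h2, fun u => ?_, fun u => ?_⟩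
      · simp [Prog.run, NExp.eval, f₂.reg rPow (round_writesReg (by norm_num)), hpow, pow_succ,
          mul_two]
      · simp [Prog.run, f₂.reg rSize (round_writesReg (by norm_num))]
      · exact f₂.nat aSrc (round_writesNat (by norm_num))
      · exact f₂.nat aDst (round_writesNat (by norm_num))
      · exact f₂.real aEdgeW (round_writesReal (by norm_num))
      · rw [← hX u, ← f₂.real aField round_writesReal_field]; rfl
      · refine (h3 u).trans (max_le (le_max_left _ _) ?_)
        have := hcard u
        rw [pow_succ, ← Nat.div_div_eq_div_mul]
        -- Classes that are already single vertices stay so; the maximum with 1 in the invariant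
        -- covers them.
        rcases le_total 1 (N / 2 ^ k) with hc | hc
        · rw [max_eq_right hc] at this
          exact le_max_of_le_right (Nat.div_le_div_right this)
        · rw [max_eq_left hc] at this
          exact le_max_of_le_left (by omega)
      · exact (h4 u).trans (hres u)
    · rintro s' ⟨hpow, ht, -⟩
      simpa [Test.Holds, NExp.eval, hpow, ht.size] using Nat.le_pow_clog (by norm_num) N
    · rintro s' ⟨hpow, ht, hX, lab, hlab, hspan, hcard, hres⟩ u
      -- The exponent is chosen with `N ≤ 2 ^ Nat.clog 2 N`, so the size bound has come down to 1.
      have hone : N / 2 ^ Nat.clog 2 N ≤ 1 := by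
        have := Nat.div_le_div_right (c := 2 ^ Nat.clog 2 N)
          (Nat.le_pow_clog (b := 2) (by norm_num) N)
        rwa [Nat.div_self (by positivity)] at this
      have := hres u
      rw [classIntegral_of_card_le_one hG f X u ((hcard u).trans (max_le le_rfl hone))] at this
      linarith
  · simp only [Finset.sum_const, Finset.card_range, smul_eq_mul]
    ring_nf
    omega

theorem exec_loadField {c D : ℕ} (z : ℝ) (hN : s.reg rSize = N) (hD : s.reg rComps = D)
    (hc : s.reg rComp = c) :
    Exec prim (loadField z : Prog ι) s (40 * N + 20) fun s' => ∀ u < N,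
      s'.real aField u = s.real aInput (u * D + c) ∧
      s'.real aRes u = z * s.real aInput (u * D + c) ∧ s'.nat aLab u = 0 := by
  refine Exec.mono (Exec.seq_of (t := 2) (t' := 26 * N + 6)
    (R := fun s' => s' = s.writeReg rAddr c) ?_ ?_) (by omega) fun _ h => h
  · refine (Exec.of_loopFree (by simp [Prog.LoopFree]) ?_).mono
      (by simp [Prog.maxCost, NExp.cost]) fun _ h => h
    simp [Prog.run, NExp.eval, hc]
  rintro _ rfl
  refine (Exec.for (n := N) (B := fun _ => 18) (fun k s' => s'.reg rAddr = k * D + c ∧ ∀ u < k,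
      s'.real aField u = s.real aInput (u * D + c) ∧
      s'.real aRes u = z * s.real aInput (u * D + c) ∧ s'.nat aLab u = 0)
      ?_ ?_ ?_ ?_ ?_).mono ?_ fun s' h => h.2
  · intro s' hf
    simp [NExp.eval, hf.reg rSize (by simp [Prog.WritesReg, loadBody]), hN]
  · simp [Prog.WritesReg, loadBody]
  · intro k s m h
    simpa using h
  · simp
  · intro k hk s' hf hi hI
    refine (Exec.of_loopFree (by simp [Prog.LoopFree, loadBody]) ?_).mono
      (by simp [loadBody, Prog.maxCost, NExp.cost, RExp.cost]) fun _ h => h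
    have e1 := hf.reg rComps (by simp [Prog.WritesReg, loadBody])
    have e2 := hf.real aInput (by simp [Prog.WritesReal, loadBody])
    refine ⟨?_, fun u hu => ?_⟩
    · simp [loadBody, Prog.run, NExp.eval, hI.1, e1, hD]; ring
    · rcases Nat.lt_succ_iff_lt_or_eq.1 hu with h | rfl
      · simpa [loadBody, Prog.run, NExp.eval, RExp.eval, hi, h.ne] using hI.2 u h
      · simp [loadBody, Prog.run, NExp.eval, RExp.eval, hi, hI.1, e2]
  · simp [NExp.cost]
    omega

theorem exec_storeField {c D : ℕ} (hN : s.reg rSize = N) (hD : s.reg rComps = D)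
    (hc : s.reg rComp = c) (hcD : c < D) :
    Exec prim (storeField : Prog ι) s (40 * N + 20) fun s' =>
      (∀ u < N, s'.real aOutput (u * D + c) = s.real aRes u) ∧
      ∀ u, ∀ c' < D, c' ≠ c → s'.real aOutput (u * D + c') = s.real aOutput (u * D + c') := by
  -- Division with remainder by `D` recovers vertex and component from an address, so stores for
  -- different pairs do not collide.
  have hinj : ∀ {u u' c' : ℕ}, c' < D → u * D + c' = u' * D + c → u = u' ∧ c' = c := by
    intro u u' c' hc' e
    have hDpos : 0 < D := by omega
    have h1 := congrArg (· / D) e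
    have h2 := congrArg (· % D) e
    simp only [mul_comm _ D, Nat.mul_add_div hDpos, Nat.mul_add_mod, Nat.div_eq_of_lt hc',
      Nat.div_eq_of_lt hcD, Nat.mod_eq_of_lt hc', Nat.mod_eq_of_lt hcD] at h1 h2
    exact ⟨by simpa using h1, h2⟩
  refine Exec.mono (Exec.seq_of (t := 2) (t' := 18 * N + 6)
    (R := fun s' => s' = s.writeReg rAddr c) ?_ ?_) (by omega) fun _ h => h
  · refine (Exec.of_loopFree (by simp [Prog.LoopFree]) ?_).mono
      (by simp [Prog.maxCost, NExp.cost]) fun _ h => h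
    simp [Prog.run, NExp.eval, hc]
  rintro _ rfl
  refine (Exec.for (n := N) (B := fun _ => 10) (fun k s' => s'.reg rAddr = k * D + c ∧
      (∀ u < k, s'.real aOutput (u * D + c) = s.real aRes u) ∧
      ∀ u, ∀ c' < D, c' ≠ c → s'.real aOutput (u * D + c') = s.real aOutput (u * D + c'))
      ?_ ?_ ?_ ?_ ?_).mono ?_ fun s' h => h.2
  · intro s' hf
    simp [NExp.eval, hf.reg rSize (by simp [Prog.WritesReg, storeBody]), hN]
  · simp [Prog.WritesReg, storeBody]
  · intro k s m h
    simpa using h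
  · simp
  · intro k hk s' hf hi hI
    refine (Exec.of_loopFree (by simp [Prog.LoopFree, storeBody]) ?_).mono
      (by simp [storeBody, Prog.maxCost, NExp.cost, RExp.cost]) fun _ h => h
    have e1 := hf.reg rComps (by simp [Prog.WritesReg, storeBody])
    have e2 := hf.real aRes (by simp [Prog.WritesReal, storeBody])
    refine ⟨?_, fun u hu => ?_, fun u c' hc' hne => ?_⟩
    · simp [storeBody, Prog.run, NExp.eval, hI.1, e1, hD]; ring
    · rcases Nat.lt_succ_iff_lt_or_eq.1 hu with h | rfl
      · have hne : u * D + c ≠ k * D + c := fun e => h.ne (hinj hcD e).1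
        simp only [storeBody, Prog.run, NExp.eval, RExp.eval, hI.1, State.writeReg_real,
          State.writeReal_real, if_true]
        rw [Function.update_of_ne hne]
        exact hI.2.1 u h
      · simp [storeBody, Prog.run, NExp.eval, RExp.eval, hi, hI.1, e2]
    · have hne' : u * D + c' ≠ k * D + c := fun e => hne (hinj hc' e).2
      simp only [storeBody, Prog.run, NExp.eval, RExp.eval, hI.1, State.writeReg_real,
        State.writeReal_real, if_true]
      rw [Function.update_of_ne hne']
      exact hI.2.2 u c' hc' hne
  · simp [NExp.cost]
    omega

/-- The tree is decomposed anew for every component. Working memory is reused without cleaning,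
since all specifications allow arbitrary contents outside their inputs. -/
theorem exec_integrate {D : ℕ} (hP : MultipliesSumMatrices prim f P T)
    (hT : ∀ n, 1 ≤ n → n ≤ N → T (n + n) ≤ n * r) (hG : G.IsTree) (ht : StoresTree s G w)
    (hD : s.reg rComps = D) :
    Exec prim (integrate P (f 0)) s
      (D * (Nat.clog 2 N * (N * (800 + 2 * r) + 310) + 80 * N + 60) + 6) fun s' =>
      ∀ c < D, ∀ u : Fin N, s'.real aOutput (u * D + c) =
        (fDistanceMatrix G w f *ᵥ fun v => s.real aInput (v * D + c)) u := by
  have hregs : ∀ x < 3, x ≠ rComp →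
      ¬ (integrate P (f 0)).WritesReg x := fun x hx hx' => by
    simp [integrate, loadField, loadBody, storeField, storeBody, rounds, Prog.WritesReg,
      round_writesReg (show x < 5 by omega), hx']
    omega
  have hnats : ∀ x < 2, ¬ (integrate P (f 0)).WritesNat x := fun x hx => by
    simp [integrate, loadField, loadBody, storeField, storeBody, rounds, Prog.WritesNat,
      round_writesNat hx]
    omega
  have hreals : ∀ x < 2, ¬ (integrate P (f 0)).WritesReal x := fun x hx => by
    simp [integrate, loadField, loadBody, storeField, storeBody, rounds, Prog.WritesReal,
      round_writesReal (show x < 3 by omega)]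
    omega
  refine (Exec.for (n := D)
    (B := fun _ => Nat.clog 2 N * (N * (800 + 2 * r) + 310) + 80 * N + 50)
    (fun k s' => ∀ c < D, c < k → ∀ u : Fin N, s'.real aOutput (u * D + c) =
        (fDistanceMatrix G w f *ᵥ fun v => s.real aInput (v * D + c)) u)
    ?_ ?_ ?_ ?_ ?_).mono ?_ fun s' h c hc => h c hc hc
  · intro s' hf
    simpa [NExp.eval] using (hf.reg rComps (hregs _ (by norm_num) (by norm_num))).trans hD
  · simp [loadField, loadBody, storeField, storeBody, rounds, Prog.WritesReg,
      round_writesReg (show 2 < 5 by omega)]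
  · intro k s m h
    simpa using h
  · simp
  · intro k hk s₀ f₀ hi hI
    have hD₀ := (f₀.reg rComps (hregs _ (by norm_num) (by norm_num))).trans hD
    have ht₀ : StoresTree s₀ G w := ht.congr (f₀.reg rSize (hregs _ (by norm_num) (by norm_num)))
      (f₀.nat _ (hnats _ (by norm_num))) (f₀.nat _ (hnats _ (by norm_num)))
      (f₀.real _ (hreals _ (by norm_num)))
    have hin₀ := f₀.real aInput (hreals _ (by norm_num))
    refine Exec.mono (t := (40 * N + 20) + ((Nat.clog 2 N * (N * (800 + 2 * r) + 310) + 10) +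
      (40 * N + 20))) ?_ (by omega) fun _ h => h
    refine Exec.seq_of (exec_loadField (f 0) ht₀.size hD₀ hi).frame ?_
    rintro s₁ ⟨h₁, f₁⟩
    have reg₁ : ∀ x < 3, s₁.reg x = s₀.reg x := fun x hx => f₁.reg x (by
      simp [loadField, loadBody, Prog.WritesReg]; omega)
    have real₁ : ∀ x < 3, s₁.real x = s₀.real x := fun x hx => f₁.real x (by
      simp [loadField, loadBody, Prog.WritesReal]; omega)
    have nat₁ : ∀ x < 2, s₁.nat x = s₀.nat x := fun x hx => f₁.nat x (by
      simp [loadField, loadBody, Prog.WritesNat]; omega)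
    refine Exec.seq_of (exec_rounds (X := fun v => s.real aInput (v * D + k)) hP hT hG
      (ht₀.congr (reg₁ _ (by norm_num)) (nat₁ _ (by norm_num)) (nat₁ _ (by norm_num))
        (real₁ _ (by norm_num))) (fun u => (h₁ u u.2).2.2)
        (fun u => by rw [(h₁ u u.2).1, hin₀]) (fun u => by rw [(h₁ u u.2).2.1, hin₀])).frame ?_
    rintro s₂ ⟨h₂, f₂⟩
    have reg₂ : ∀ x < 3, s₂.reg x = s₁.reg x := fun x hx => f₂.reg x (by
      simp [rounds, Prog.WritesReg, round_writesReg (show x < 5 by omega)]; omega)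
    have real₂ : ∀ x < 3, s₂.real x = s₁.real x := fun x hx => f₂.real x (by
      simp [rounds, Prog.WritesReal, round_writesReal hx])
    refine (exec_storeField (N := N) (c := k) (D := D)
      (by rw [reg₂ _ (by norm_num), reg₁ _ (by norm_num), ht₀.size])
      (by rw [reg₂ _ (by norm_num), reg₁ _ (by norm_num), hD₀])
      (by rw [reg₂ _ (by norm_num), reg₁ _ (by norm_num), hi]) hk).mono le_rfl ?_
    rintro s₃ ⟨h₃, h₃'⟩ c hc hck u
    rcases Nat.lt_succ_iff_lt_or_eq.1 hck with h | rfl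
    · rw [h₃' u c hc h.ne, real₂ _ (by norm_num), real₁ _ (by norm_num), hI c hc h]
    · rw [h₃ u u.2, h₂ u]
  · simp [NExp.cost]
    ring_nf
    omega

end

end RealRAM

/-! ### Asymptotics -/

/-- A number `r` with `T (2 * n) ≤ n * r` for `1 ≤ n ≤ N`. -/
def doubledRate (T : ℕ → ℕ) (N : ℕ) : ℕ := (Finset.range (N + 1)).sup fun n => T (n + n) / n + 1

theorem le_mul_doubledRate (T : ℕ → ℕ) {n N : ℕ} (hn : 1 ≤ n) (hnN : n ≤ N) :
    T (n + n) ≤ n * doubledRate T N := by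
  have h : T (n + n) / n + 1 ≤ doubledRate T N :=
    Finset.le_sup (f := fun n => T (n + n) / n + 1) (Finset.mem_range.2 (by omega))
  exact (Nat.lt_mul_div_succ _ hn).le.trans (Nat.mul_le_mul_left _ h)

theorem one_le_log_of_three_le {n : ℕ} (hn : 3 ≤ n) : 1 ≤ Real.log n := by
  have hn' : (3 : ℝ) ≤ n := by exact_mod_cast hn
  rw [Real.le_log_iff_exp_le (by linarith)]
  exact Real.exp_one_lt_three.le.trans hn'

/-- The maximum in `doubledRate` makes monotonicity of `T` unnecessary. The finitely many `n` below
the threshold of the asymptotic bound contribute a constant; beyond it, `T (2 * n) / n ≤ 2 * C * log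
(2 * n) ^ d`, and `log (2 * n) ≤ 2 * log N`. -/
theorem doubledRate_isBigO {T : ℕ → ℕ} {d : ℕ}
    (hT : (fun n => (T n : ℝ)) =O[atTop] fun n : ℕ => (n : ℝ) * Real.log n ^ d) :
    (fun N => (doubledRate T N : ℝ)) =O[atTop] fun N : ℕ => Real.log N ^ d := by
  obtain ⟨C, hC0, hC⟩ := hT.exists_nonneg
  rw [isBigOWith_iff, eventually_atTop] at hC
  obtain ⟨n₀, hn₀⟩ := hC
  set K := (Finset.range n₀).sup fun n => T (n + n) with hK
  refine IsBigO.of_bound (K + 1 + 2 * C * 2 ^ d) ?_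
  filter_upwards [eventually_ge_atTop 3] with N hN
  have hlog := one_le_log_of_three_le hN
  have hpow : 1 ≤ Real.log N ^ d := one_le_pow₀ hlog
  rw [Real.norm_of_nonneg (Nat.cast_nonneg _), Real.norm_of_nonneg (by positivity)]
  obtain ⟨n, hn, heq⟩ := Finset.exists_mem_eq_sup (Finset.range (N + 1)) ⟨0, by simp⟩
    fun n => T (n + n) / n + 1
  rw [doubledRate, heq]
  have hnN : n ≤ N := by simpa [Nat.lt_succ_iff] using hn
  push_cast
  have hB : 0 ≤ 2 * C * 2 ^ d * Real.log N ^ d := by positivity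
  have hKl : (K : ℝ) + 1 ≤ (K + 1) * Real.log N ^ d := by
    have : (0 : ℝ) ≤ K := Nat.cast_nonneg _
    nlinarith
  rcases Nat.eq_zero_or_pos n with rfl | hpos
  · simp only [Nat.div_zero, Nat.cast_zero, zero_add]
    nlinarith [(Nat.cast_nonneg K : (0 : ℝ) ≤ K)]
  · have hn' : (0 : ℝ) < n := by exact_mod_cast hpos
    rcases lt_or_ge n n₀ with hlt | hge
    · have h1 : T (n + n) / n ≤ K := (Nat.div_le_self _ _).trans
        (Finset.le_sup (f := fun n => T (n + n)) (Finset.mem_range.2 hlt))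
      have h1' : ((T (n + n) / n : ℕ) : ℝ) ≤ K := by exact_mod_cast h1
      nlinarith
    · have h1 := hn₀ (n + n) (by omega)
      have hlogn : 0 ≤ Real.log ((n + n : ℕ) : ℝ) := Real.log_natCast_nonneg _
      rw [Real.norm_of_nonneg (Nat.cast_nonneg _), Real.norm_of_nonneg (by positivity)] at h1
      have h2 : Real.log ((n + n : ℕ) : ℝ) ≤ 2 * Real.log N := by
        have hN' : (2 : ℝ) ≤ N := by exact_mod_cast (by omega : 2 ≤ N)
        -- From `2 ≤ N` and `n ≤ N` one gets `2 * n ≤ N ^ 2`.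
        rw [← Nat.cast_two, ← Real.log_pow]
        refine Real.log_le_log (by exact_mod_cast (by omega)) ?_
        have : (n : ℝ) ≤ N := by exact_mod_cast hnN
        push_cast
        nlinarith
      have h3 : Real.log ((n + n : ℕ) : ℝ) ^ d ≤ 2 ^ d * Real.log N ^ d := by
        rw [← mul_pow]
        exact pow_le_pow_left₀ hlogn h2 d
      have h4 : ((T (n + n) / n : ℕ) : ℝ) ≤ T (n + n) / n := Nat.cast_div_le
      have h5 : (T (n + n) : ℝ) / n ≤ 2 * C * 2 ^ d * Real.log N ^ d := by
        rw [div_le_iff₀ hn']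
        refine h1.trans ?_
        push_cast at h3 ⊢
        have := mul_le_mul_of_nonneg_left h3 (by positivity : 0 ≤ C * (n + n))
        nlinarith
      nlinarith

theorem clog_isBigO_log : (fun N => (Nat.clog 2 N + 1 : ℝ)) =O[atTop] fun N : ℕ => Real.log N := by
  refine IsBigO.of_bound (1 / Real.log 2 + 2) ?_
  filter_upwards [eventually_ge_atTop 3] with N hN
  have hlog := one_le_log_of_three_le hN
  rw [Real.norm_of_nonneg (by positivity), Real.norm_of_nonneg (by positivity)]
  have h1 : Nat.clog 2 N ≤ Nat.log 2 N + 1 :=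
    Nat.clog_le_of_le_pow (Nat.lt_pow_succ_log_self (by norm_num) N).le
  have h1' : (Nat.clog 2 N : ℝ) ≤ Nat.log 2 N + 1 := by exact_mod_cast h1
  have h2 : (Nat.log 2 N : ℝ) ≤ Real.log N / Real.log 2 := by
    simpa [Real.logb] using Real.natLog_le_logb N 2
  have : (1 / Real.log 2 + 2) * Real.log N = Real.log N / Real.log 2 + 2 * Real.log N := by ring
  linarith

/-- Time per component of the integration on trees. -/
def integrationTime (T : ℕ → ℕ) (N : ℕ) : ℕ :=
  2000 * (N * ((Nat.clog 2 N + 1) * doubledRate T N))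

theorem integrationTime_isBigO {T : ℕ → ℕ} {d : ℕ}
    (hT : (fun n => (T n : ℝ)) =O[atTop] fun n : ℕ => (n : ℝ) * Real.log n ^ d) :
    (fun N => (integrationTime T N : ℝ)) =O[atTop]
      fun N : ℕ => (N : ℝ) * Real.log N ^ (d + 1) := by
  have h := ((isBigO_refl (fun N : ℕ => (N : ℝ)) atTop).mul
    (clog_isBigO_log.mul (doubledRate_isBigO hT))).const_mul_left 2000
  refine (h.congr_left fun N => ?_).congr_right fun N => ?_
  · simp [integrationTime]
  · rw [pow_succ']

/-- The index 0 belongs to the range and contributes 1, because division by zero gives 0. -/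
theorem one_le_doubledRate (T : ℕ → ℕ) (N : ℕ) : 1 ≤ doubledRate T N :=
  le_trans (by omega : 1 ≤ T (0 + 0) / 0 + 1)
    (Finset.le_sup (f := fun n => T (n + n) / n + 1) (Finset.mem_range.2 (by omega : 0 < N + 1)))

theorem lemma3p2 {ι : Type*} (prim : ι → ℝ → ℝ) (f : ℝ → ℝ) (d : ℕ) (hf : IsCordial prim d f) :
    ∃ (P : RealRAM.Prog ι) (T : ℕ → ℕ),
      (fun N => (T N : ℝ)) =O[atTop] (fun N : ℕ => (N : ℝ) * Real.log N ^ (d + 1)) ∧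
      IntegratesTreeFields prim f P T := by
  obtain ⟨P, T, hT, hP⟩ := hf
  refine ⟨RealRAM.integrate P (f 0), integrationTime T, integrationTime_isBigO hT, ?_⟩
  intro N G w hG _ m dims hdims X s hs
  have hD : 1 ≤ ∏ i, dims i := Finset.one_le_prod' fun i _ => hdims i
  have hN : 1 ≤ N := (Classical.choice hG.1.nonempty).pos
  obtain ⟨t, s', hrun, ht, hout⟩ := RealRAM.exec_integrate hP
    (fun n h1 h2 => le_mul_doubledRate T h1 h2) hG ⟨hs.vertices, hs.edges⟩ hs.components
  refine ⟨t, s', hrun, ht.trans ?_, fun u c => ?_⟩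
  · have hr := one_le_doubledRate T N
    rw [integrationTime, mul_comm _ (∏ i, dims i)]
    set D := ∏ i, dims i
    set k := Nat.clog 2 N
    set r := doubledRate T N
    -- As `N` and `r` are at least 1, every term is at most a constant times `N * (k + 1) * r`; 2000
    -- exceeds the sum of these constants.
    have h1 : k * (N * (800 + 2 * r) + 310) + 80 * N + 66 ≤ 2000 * (N * ((k + 1) * r)) := by
      have e1 : 1 ≤ N * r := Nat.one_le_iff_ne_zero.2 (by positivity)
      have e2 : N ≤ N * r := Nat.le_mul_of_pos_right _ hr
      have e3 := Nat.mul_le_mul_left k e1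
      have e4 := Nat.mul_le_mul_left k e2
      ring_nf at e3 e4 ⊢
      omega
    -- The overhead outside the loop over the components is charged to the components, of which
    -- there is at least one.
    calc D * (k * (N * (800 + 2 * r) + 310) + 80 * N + 60) + 6
        ≤ D * (k * (N * (800 + 2 * r) + 310) + 80 * N + 66) := by
          have key : ∀ M, D * (M + 60) + 6 ≤ D * (M + 66) := fun M => by nlinarith
          exact key (k * (N * (800 + 2 * r) + 310) + 80 * N)
      _ ≤ _ := Nat.mul_le_mul_left D h1
  · rw [hout _ (finPiFinEquiv c).2 u]
    simp only [hs.field]
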